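/- An instance of the egalitarian repeated matching problem consists of $n\ge 1$ agents $N=\{1,\dots,n\}$, a set $G$ of $m\ge n$ goods, a number $T\ge 1$ of rounds, and non-negative rational values $u_i(g)$ for $i\in N$, $g\in G$. A matching is an injective map $M:N\to G$. For a sequence $S=(M^1,\dots,M^T)$ of $T$ matchings, agent $i$ receives $v_i^T(S)=\sum_{s=1}^{T}u_i(M^s(i))$; the bottleneck value of $S$ is $b^T(S)=\min_{i\in N}v_i^T(S)$, and $S$ is optimal if $b^T(S)$ is maximal among all sequences of $T$ matchings. The instance has two types of goods if $G=G_0\cup G_1$ with $G_0\cap G_1=\emptyset$ such that for each $r\in\{0,1\}$, all $i\in N$ and all $g,g'\in G_r$ we have $u_i(g)=u_i(g')$. Theorem. There is an algorithm that, given an instance with two types of goods (that is, $n$, $m$, $T$ and the numerators and denominators of all values $u_i(g)$, written in binary; the partition $G_0\cup G_1$ is not part of the input), finds an optimal sequence of $T$ matchings in time polynomial in the bit length of the input. The sequence is output in run-length form: a list of pairs $(c_k,M_k)$, meaning $c_1$ rounds with the matching $M_1$, then $c_2$ rounds with $M_2$, and so on, where $\sum_k c_k=T$. (Running time is the cost on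 a random access machine with logarithmic cost, i.e. each instruction is charged one unit plus the bit lengths of the numbers it handles.) -/

import Mathlib

/-! ### A random access machine with logarithmic cost

Programs are structured.  The machine has registers (addressed by numbers written in the program),
a work memory (addressed indirectly, through registers), a read-only input and a write-only output.
All cells hold natural numbers.  Every instruction is charged one unit plus the bit lengths of the
numbers it handles, addresses included, so running time is polynomially related to Turing machine
time. -/

namespace RAM

/-- Programs.  Below, `r` is the content of the registers. -/
inductive Prog : Type
  /-- no effect -/
  | skip : Prog
  /-- `r i := c` -/
  | const (i c : ℕ) : Prog
  /-- `r i := r j` -/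
  | copy (i j : ℕ) : Prog
  /-- `r i := r j + r k` -/
  | add (i j k : ℕ) : Prog
  /-- `r i := r j - r k`, truncated at zero -/
  | sub (i j k : ℕ) : Prog
  /-- `r i := r j * r k` -/
  | mul (i j k : ℕ) : Prog
  /-- `r i := ⌊r j / r k⌋`, and zero if `r k = 0` -/
  | div (i j k : ℕ) : Prog
  /-- `r i :=` the length of the input -/
  | inputLen (i : ℕ) : Prog
  /-- `r i :=` the input entry at position `r j` (zero beyond the end of the input) -/
  | input (i j : ℕ) : Prog
  /-- `r i :=` the content of the memory cell with address `r j` -/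
  | load (i j : ℕ) : Prog
  /-- memory cell with address `r i` `:= r j` -/
  | store (i j : ℕ) : Prog
  /-- append `r i` to the output -/
  | write (i : ℕ) : Prog
  /-- sequential composition -/
  | seq (p q : Prog) : Prog
  /-- run `p` if `r i ≠ 0`, and `q` otherwise -/
  | cond (i : ℕ) (p q : Prog) : Prog
  /-- run `p` as long as `r i ≠ 0` -/
  | loop (i : ℕ) (p : Prog) : Prog

/-- The state of the machine: registers, work memory, output written so far. -/
structure State where
  reg : ℕ → ℕ
  mem : ℕ → ℕ
  out : List ℕ

/-- Initially registers and memory are zero and the output is empty. -/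
def State.init : State := ⟨fun _ => 0, fun _ => 0, []⟩

/-- Write `v` into register `i`. -/
def State.setReg (s : State) (i v : ℕ) : State := { s with reg := Function.update s.reg i v }

/-- Write `v` into the memory cell with address `a`. -/
def State.setMem (s : State) (a v : ℕ) : State := { s with mem := Function.update s.mem a v }

/-- `Exec x p s s' t`: on input `x`, the program `p` started in state `s` halts in state `s'`,
at total cost `t`.  (`Nat.size` is the length of the binary expansion.) -/
inductive Exec (x : List ℕ) : Prog → State → State → ℕ → Prop
  | skip (s : State) : Exec x .skip s s 1
  | const (s : State) (i c : ℕ) : Exec x (.const i c) s (s.setReg i c) (1 + c.size)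
  | copy (s : State) (i j : ℕ) :
      Exec x (.copy i j) s (s.setReg i (s.reg j)) (1 + (s.reg j).size)
  | add (s : State) (i j k : ℕ) :
      Exec x (.add i j k) s (s.setReg i (s.reg j + s.reg k))
        (1 + (s.reg j).size + (s.reg k).size)
  | sub (s : State) (i j k : ℕ) :
      Exec x (.sub i j k) s (s.setReg i (s.reg j - s.reg k))
        (1 + (s.reg j).size + (s.reg k).size)
  | mul (s : State) (i j k : ℕ) :
      Exec x (.mul i j k) s (s.setReg i (s.reg j * s.reg k))
        (1 + (s.reg j).size + (s.reg k).size)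
  | div (s : State) (i j k : ℕ) :
      Exec x (.div i j k) s (s.setReg i (s.reg j / s.reg k))
        (1 + (s.reg j).size + (s.reg k).size)
  | inputLen (s : State) (i : ℕ) :
      Exec x (.inputLen i) s (s.setReg i x.length) (1 + x.length.size)
  | input (s : State) (i j : ℕ) :
      Exec x (.input i j) s (s.setReg i (x.getD (s.reg j) 0))
        (1 + (s.reg j).size + (x.getD (s.reg j) 0).size)
  | load (s : State) (i j : ℕ) :
      Exec x (.load i j) s (s.setReg i (s.mem (s.reg j)))
        (1 + (s.reg j).size + (s.mem (s.reg j)).size)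
  | store (s : State) (i j : ℕ) :
      Exec x (.store i j) s (s.setMem (s.reg i) (s.reg j))
        (1 + (s.reg i).size + (s.reg j).size)
  | write (s : State) (i : ℕ) :
      Exec x (.write i) s { s with out := s.out ++ [s.reg i] } (1 + (s.reg i).size)
  | seq {p q : Prog} {s s' s'' : State} {t t' : ℕ} :
      Exec x p s s' t → Exec x q s' s'' t' → Exec x (.seq p q) s s'' (t + t')
  | condTrue {i : ℕ} {p q : Prog} {s s' : State} {t : ℕ} :
      s.reg i ≠ 0 → Exec x p s s' t → Exec x (.cond i p q) s s' (1 + (s.reg i).size + t)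
  | condFalse {i : ℕ} {p q : Prog} {s s' : State} {t : ℕ} :
      s.reg i = 0 → Exec x q s s' t → Exec x (.cond i p q) s s' (1 + (s.reg i).size + t)
  | loopStop {i : ℕ} {p : Prog} {s : State} :
      s.reg i = 0 → Exec x (.loop i p) s s (1 + (s.reg i).size)
  | loopStep {i : ℕ} {p : Prog} {s s' s'' : State} {t t' : ℕ} :
      s.reg i ≠ 0 → Exec x p s s' t → Exec x (.loop i p) s' s'' t' →
        Exec x (.loop i p) s s'' (1 + (s.reg i).size + t + t')

/-- The size of an input: the number of symbols needed to write its entries in binary, each followed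
by a separator. -/
def inputSize (x : List ℕ) : ℕ := (x.map fun a => a.size + 1).sum

/-- The search problem "given (the encoding of) an `a` in `dom`, find a `y` with `good a y`" is
solved by one program whose cost is bounded by one polynomial in the size of the input. -/
def SolvableInPolyTime {α : Type*} (encode : α → List ℕ) (dom : Set α)
    (good : α → List ℕ → Prop) : Prop :=
  ∃ (p : Prog) (q : Polynomial ℕ), ∀ a ∈ dom, ∃ (s : State) (t : ℕ),
    Exec (encode a) p State.init s t ∧ t ≤ q.eval (inputSize (encode a)) ∧ good a s.out

end RAM

/-! ### Egalitarian repeated matching -/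

/-- An instance: `n` agents, `m ≥ n` goods, `T` rounds, and non-negative (rational) values
`u i g` of agent `i` for good `g`. -/
structure RepeatedMatching where
  n : ℕ
  m : ℕ
  T : ℕ
  n_pos : 0 < n
  n_le_m : n ≤ m
  T_pos : 0 < T
  u : Fin n → Fin m → ℚ≥0

namespace RepeatedMatching

/-- A matching is an injective map from agents to goods. -/
abbrev Matching (I : RepeatedMatching) : Type := Fin I.n ↪ Fin I.m

/-- The value `v_i^t(S)` that agent `i` receives in the first `t` rounds of the sequence `S`. -/
def value (I : RepeatedMatching) (S : List I.Matching) (t : ℕ) (i : Fin I.n) : ℚ≥0 :=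
  ((S.take t).map fun M => I.u i (M i)).sum

/-- The bottleneck value `b^t(S)`: the least of the values `v_i^t(S)`. -/
def bottleneck (I : RepeatedMatching) (t : ℕ) (S : List I.Matching) : ℚ≥0 :=
  Finset.univ.inf' ⟨⟨0, I.n_pos⟩, Finset.mem_univ _⟩ (I.value S t)

/-- The sequences of matchings of length at least `t`. -/
def sequences (I : RepeatedMatching) (t : ℕ) : Set (List I.Matching) := {S | t ≤ S.length}

/-- `S` is optimal at round `t`: it has length at least `t`, and its bottleneck value at round `t`
is the maximum of the bottleneck values at round `t` of all such sequences. -/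
def IsOptimalAt (I : RepeatedMatching) (t : ℕ) (S : List I.Matching) : Prop :=
  S ∈ I.sequences t ∧ IsGreatest (I.bottleneck t '' I.sequences t) (I.bottleneck t S)

/-- The goods split into two groups such that every agent values all goods of a group equally. -/
def TwoTypes (I : RepeatedMatching) : Prop :=
  ∃ G : Fin 2 → Set (Fin I.m), G 0 ∩ G 1 = ∅ ∧ G 0 ∪ G 1 = Set.univ ∧
    ∀ (i : Fin I.n) (r : Fin 2), ∀ g ∈ G r, ∀ g' ∈ G r, I.u i g = I.u i g'

/-- The input format: `n`, `m`, `T`, and then row by row the values `u i g`, each given by its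
numerator and its denominator (in lowest terms). -/
def encode (I : RepeatedMatching) : List ℕ :=
  I.n :: I.m :: I.T :: (List.finRange I.n).flatMap fun i =>
    (List.finRange I.m).flatMap fun g => [(I.u i g).num, (I.u i g).den]

/-- A run-length description `[(c₁, M₁), (c₂, M₂), …]` stands for the sequence that consists of
`c₁` times `M₁`, then `c₂` times `M₂`, and so on. -/
def expand (I : RepeatedMatching) (L : List (ℕ × I.Matching)) : List I.Matching :=
  L.flatMap fun b => List.replicate b.1 b.2

/-- The output format: the run-length description, block by block, each block being written as the
number of repetitions followed by the `n` goods that agents `0, …, n - 1` are matched to. -/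
def encodeRuns (I : RepeatedMatching) (L : List (ℕ × I.Matching)) : List ℕ :=
  L.flatMap fun b => b.1 :: List.ofFn fun i => (b.2 i : ℕ)

/-- `y` is a run-length description of a sequence of `T` matchings that is optimal at round `T`. -/
def IsOptimalOutput (I : RepeatedMatching) (y : List ℕ) : Prop :=
  ∃ L : List (ℕ × I.Matching), y = I.encodeRuns L ∧
    (I.expand L).length = I.T ∧ I.IsOptimalAt I.T (I.expand L)

end RepeatedMatching

/-! With two types of goods, a round matters only through the set of agents that get a good of type
1. The size of this set lies between `minOnes` (type 0 can run out) and `maxOnes` (type 1 can run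
out). Over `T` rounds, the value of agent `i` depends only on the number `x i` of rounds in which it
gets type 1, and is affine in `x i`. So after scaling to integers, a target `v` confines each `x i`
to an interval `[lower, upper]` (`le_reach_iff`), while the sum of all `x i` lies between `T *
minOnes` and `T * maxOnes` (`sum_ones`). Such an `x` exists iff the intervals are nonempty and their
sum meets the allowed range; this is `Feasible`, and the largest feasible target is found by
bisection.

Conversely, every such `x` comes from a schedule, by a wrap-around argument. With partial sums `c i`
of `x`, let `(c i + t) / T` be the number of agents before `i` that get type 1 in round `t`.
Consecutive quotients differ by 0 or 1 because `x i ≤ T`; the last one lies between `minOnes` and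
`maxOnes`; and summing over `t < T` gives back `c i` (`sum_add_div`), so agent `i` gets type 1
exactly `x i` times. Each quotient jumps at most once while `t` runs through the rounds, hence the
matchings form at most `n + 1` constant blocks.

For the running time, `T` is bounded only in bit length, so no loop may run over rounds; loops run
over agents, goods, bits and blocks. Programs are built by combinators for `Does`. They use
registers like a stack: a computation based at `b` leaves everything below `b` intact. The work
memory is never needed. -/

namespace RAM

/-! ### Computing functions and output lists within polynomial cost -/

section Framework

variable {α : Type} {enc : α → List ℕ}

/-- A context: every `γ : Γ` belongs to the instance `inst γ`, and determines some of the contents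
of the registers below `arity`, as expressed by `Holds γ`. -/
structure Ctx (enc : α → List ℕ) (Γ : Type) where
  inst : Γ → α
  arity : ℕ
  Holds : Γ → (ℕ → ℕ) → Prop
  congr : ∀ γ r r', (∀ j < arity, r' j = r j) → Holds γ r → Holds γ r'

namespace Ctx

variable {Γ Δ : Type} {C : Ctx enc Γ}

/-! ### Polynomially bounded quantities and refinement of contexts -/

/-- The size of the input that belongs to `γ`. -/
def len (C : Ctx enc Γ) (γ : Γ) : ℕ := inputSize (enc (C.inst γ))

/-- `f` is bounded by a polynomial in the size of the input. -/
def Bdd (C : Ctx enc Γ) (f : Γ → ℕ) : Prop :=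
  ∃ q : Polynomial ℕ, ∀ γ, f γ ≤ q.eval (C.len γ)

theorem Bdd.of_le {f g : Γ → ℕ} (hg : C.Bdd g) (h : ∀ γ, f γ ≤ g γ) : C.Bdd f := by
  obtain ⟨q, hq⟩ := hg
  exact ⟨q, fun γ => (h γ).trans (hq γ)⟩

theorem Bdd.const (k : ℕ) : C.Bdd fun _ => k := ⟨Polynomial.C k, fun γ => by simp⟩

theorem Bdd.len : C.Bdd C.len := ⟨Polynomial.X, fun γ => by simp⟩

theorem Bdd.add {f g : Γ → ℕ} (hf : C.Bdd f) (hg : C.Bdd g) : C.Bdd fun γ => f γ + g γ := by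
  obtain ⟨q, hq⟩ := hf
  obtain ⟨q', hq'⟩ := hg
  exact ⟨q + q', fun γ => by simpa using add_le_add (hq γ) (hq' γ)⟩

theorem Bdd.mul {f g : Γ → ℕ} (hf : C.Bdd f) (hg : C.Bdd g) : C.Bdd fun γ => f γ * g γ := by
  obtain ⟨q, hq⟩ := hf
  obtain ⟨q', hq'⟩ := hg
  exact ⟨q * q', fun γ => by simpa using Nat.mul_le_mul (hq γ) (hq' γ)⟩

theorem Bdd.size {f : Γ → ℕ} (hf : C.Bdd f) : C.Bdd fun γ => (f γ).size :=
  hf.of_le fun _ => Nat.size_le.2 Nat.lt_two_pow_self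

/-- `C'` refines `C` along `π`. -/
structure Refines (C' : Ctx enc Δ) (C : Ctx enc Γ) (π : Δ → Γ) : Prop where
  inst : ∀ δ, C'.inst δ = C.inst (π δ)
  arity : C.arity ≤ C'.arity
  holds : ∀ δ r, C'.Holds δ r → C.Holds (π δ) r

theorem Refines.len {C' : Ctx enc Δ} {π : Δ → Γ} (h : C'.Refines C π) (δ : Δ) :
    C'.len δ = C.len (π δ) := by
  simp [Ctx.len, h.inst]

theorem Bdd.comp {C' : Ctx enc Δ} {π : Δ → Γ} {f : Γ → ℕ} (hf : C.Bdd f) (h : C'.Refines C π) :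
    C'.Bdd fun δ => f (π δ) := by
  obtain ⟨q, hq⟩ := hf
  exact ⟨q, fun δ => by simpa [h.len] using hq (π δ)⟩

/-- For every `b ≥ C.arity` there is a program of polynomial cost that puts `f γ` into register `b`,
appends `g γ` to the output, and leaves the registers below `b` unchanged. -/
def Does (C : Ctx enc Γ) (f : Γ → ℕ) (g : Γ → List ℕ) : Prop :=
  C.Bdd (fun γ => (f γ).size) ∧ ∀ b ≥ C.arity, ∃ (p : Prog) (c : Γ → ℕ), C.Bdd c ∧
    ∀ γ s, C.Holds γ s.reg → ∃ s' t, Exec (enc (C.inst γ)) p s s' t ∧ t ≤ c γ ∧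
      s'.reg b = f γ ∧ (∀ j < b, s'.reg j = s.reg j) ∧ s'.out = s.out ++ g γ

/-- `f` can be computed within polynomial cost. -/
def Comp (C : Ctx enc Γ) (f : Γ → ℕ) : Prop := C.Does f fun _ => []

/-- `P` can be decided within polynomial cost. -/
def Decides (C : Ctx enc Γ) (P : Γ → Prop) [DecidablePred P] : Prop :=
  C.Comp fun γ => if P γ then 1 else 0

/-- `g` can be written to the output within polynomial cost. -/
def Emits (C : Ctx enc Γ) (g : Γ → List ℕ) : Prop := C.Does (fun _ => 0) g

theorem Comp.bdd {f : Γ → ℕ} (h : C.Comp f) : C.Bdd fun γ => (f γ).size := h.1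

theorem Does.weaken {C' : Ctx enc Δ} {π : Δ → Γ} {f : Γ → ℕ} {g : Γ → List ℕ} (hf : C.Does f g)
    (h : C'.Refines C π) : C'.Does (fun δ => f (π δ)) (fun δ => g (π δ)) := by
  refine ⟨hf.1.comp h, fun b hb => ?_⟩
  obtain ⟨p, c, hc, hp⟩ := hf.2 b (h.arity.trans hb)
  refine ⟨p, fun δ => c (π δ), hc.comp h, fun δ s hs => ?_⟩
  rw [h.inst]
  exact hp (π δ) s (h.holds δ _ hs)

theorem Comp.weaken {C' : Ctx enc Δ} {π : Δ → Γ} {f : Γ → ℕ} (hf : C.Comp f)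
    (h : C'.Refines C π) : C'.Comp fun δ => f (π δ) :=
  Does.weaken hf h

/-! ### Straight-line arithmetic, branching and decisions -/

theorem Comp.const (k : ℕ) : C.Comp fun _ => k := by
  refine ⟨Bdd.const _, fun b _ => ⟨.const b k, fun _ => 1 + k.size, Bdd.const _, fun γ s _ =>
    ⟨_, _, .const s b k, le_rfl, ?_, fun j hj => ?_, ?_⟩⟩⟩
  · simp [State.setReg]
  · simp [State.setReg, hj.ne]
  · simp [State.setReg]

theorem Comp.ofReg {f : Γ → ℕ} (i : ℕ) (hi : ∀ γ r, C.Holds γ r → r i = f γ)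
    (hf : C.Bdd fun γ => (f γ).size) : C.Comp f := by
  refine ⟨hf, fun b _ => ⟨.copy b i, fun γ => 1 + (f γ).size, (Bdd.const 1).add hf, fun γ s hs =>
    ⟨_, _, .copy s b i, ?_, ?_, fun j hj => ?_, ?_⟩⟩⟩
  · simp [hi γ _ hs]
  · simp [State.setReg, hi γ _ hs]
  · simp [State.setReg, hj.ne]
  · simp [State.setReg]

theorem size_getD_le (x : List ℕ) (i : ℕ) : (x.getD i 0).size ≤ inputSize x := by
  unfold inputSize
  induction x generalizing i with
  | nil => simp
  | cons a x ih =>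
    cases i with
    | zero => simp; omega
    | succ i => have := ih i; simp at this ⊢; omega

theorem Comp.input {f : Γ → ℕ} (hf : C.Comp f) :
    C.Comp fun γ => (enc (C.inst γ)).getD (f γ) 0 := by
  refine ⟨Bdd.len.of_le fun γ => size_getD_le _ _, fun b hb => ?_⟩
  obtain ⟨p, c, hc, hp⟩ := hf.2 b hb
  refine ⟨.seq p (.input b b), fun γ => c γ + (1 + (f γ).size + C.len γ),
    hc.add (((Bdd.const 1).add hf.1).add Bdd.len), fun γ s hs => ?_⟩
  obtain ⟨s', t, he, ht, hb', hj, ho⟩ := hp γ s hs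
  refine ⟨_, _, .seq he (.input s' b b), ?_, ?_, fun j h => ?_, ?_⟩
  · have := size_getD_le (enc (C.inst γ)) (f γ)
    rw [hb']
    dsimp only [Ctx.len]
    omega
  · simp [State.setReg, hb']
  · simp [State.setReg, h.ne, hj j h]
  · simpa [State.setReg] using ho

/-- The second operand is computed at base `b + 1`, so the first one survives in register `b`. -/
theorem Comp.binary {f g : Γ → ℕ} (op : ℕ → ℕ → ℕ) (ins : ℕ → ℕ → ℕ → Prog)
    (hins : ∀ x s i j k, Exec x (ins i j k) s (s.setReg i (op (s.reg j) (s.reg k)))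
      (1 + (s.reg j).size + (s.reg k).size))
    (hop : ∀ a b, (op a b).size ≤ a.size + b.size + 1) (hf : C.Comp f) (hg : C.Comp g) :
    C.Comp fun γ => op (f γ) (g γ) := by
  refine ⟨((hf.1.add hg.1).add (Bdd.const 1)).of_le fun γ => hop _ _, fun b hb => ?_⟩
  obtain ⟨p, c, hc, hp⟩ := hf.2 b hb
  obtain ⟨p', c', hc', hp'⟩ := hg.2 (b + 1) (by omega)
  refine ⟨.seq p (.seq p' (ins b b (b + 1))),
    fun γ => c γ + (c' γ + (1 + (f γ).size + (g γ).size)),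
    hc.add (hc'.add (((Bdd.const 1).add hf.1).add hg.1)), fun γ s hs => ?_⟩
  obtain ⟨s₁, t₁, he₁, ht₁, hb₁, hj₁, ho₁⟩ := hp γ s hs
  obtain ⟨s₂, t₂, he₂, ht₂, hb₂, hj₂, ho₂⟩ :=
    hp' γ s₁ (C.congr _ _ _ (fun j hj => hj₁ j (by omega)) hs)
  have h := hj₂ b (by omega)
  refine ⟨_, _, .seq he₁ (.seq he₂ (hins _ s₂ b b (b + 1))), ?_, ?_, fun j hj => ?_, ?_⟩
  · rw [h, hb₁, hb₂]; dsimp only; omega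
  · simp [State.setReg, hb₂, h, hb₁]
  · simp [State.setReg, hj.ne, hj₂ j (by omega), hj₁ j hj]
  · simpa [State.setReg, ho₁] using ho₂

theorem size_add_le (a b : ℕ) : (a + b).size ≤ a.size + b.size + 1 := by
  rw [Nat.size_le]
  have ha := Nat.lt_size_self a
  have hb := Nat.lt_size_self b
  have h1 : 2 ^ a.size ≤ 2 ^ (a.size + b.size) := Nat.pow_le_pow_right (by simp) (by omega)
  have h2 : 2 ^ b.size ≤ 2 ^ (a.size + b.size) := Nat.pow_le_pow_right (by simp) (by omega)
  rw [pow_succ]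
  omega

theorem size_mul_le (a b : ℕ) : (a * b).size ≤ a.size + b.size := by
  rw [Nat.size_le, pow_add]
  exact Nat.mul_lt_mul'' (Nat.lt_size_self a) (Nat.lt_size_self b)

theorem Comp.add {f g : Γ → ℕ} (hf : C.Comp f) (hg : C.Comp g) : C.Comp fun γ => f γ + g γ :=
  hf.binary _ .add (fun _ => .add) size_add_le hg

theorem Comp.sub {f g : Γ → ℕ} (hf : C.Comp f) (hg : C.Comp g) : C.Comp fun γ => f γ - g γ :=
  hf.binary _ .sub (fun _ => .sub)
    (fun a b => (Nat.size_le_size (Nat.sub_le a b)).trans (by omega)) hg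

theorem Comp.mul {f g : Γ → ℕ} (hf : C.Comp f) (hg : C.Comp g) : C.Comp fun γ => f γ * g γ :=
  hf.binary _ .mul (fun _ => .mul) (fun a b => (size_mul_le a b).trans (by omega)) hg

theorem Comp.div {f g : Γ → ℕ} (hf : C.Comp f) (hg : C.Comp g) : C.Comp fun γ => f γ / g γ :=
  hf.binary _ .div (fun _ => .div)
    (fun a b => (Nat.size_le_size (Nat.div_le_self a b)).trans (by omega)) hg

theorem Comp.mod {f g : Γ → ℕ} (hf : C.Comp f) (hg : C.Comp g) : C.Comp fun γ => f γ % g γ := by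
  simp_rw [Nat.mod_eq_sub]
  exact hf.sub (hg.mul (hf.div hg))

/-- Branching on the value of a computable function. -/
theorem Comp.cases {c f f' : Γ → ℕ} (hc : C.Comp c) (hf : C.Comp f) (hf' : C.Comp f') :
    C.Comp fun γ => if c γ = 0 then f' γ else f γ := by
  refine ⟨(hf.1.add hf'.1).of_le fun γ => by dsimp only; split_ifs <;> omega, fun b hb => ?_⟩
  obtain ⟨p, k, hk, hp⟩ := hc.2 b hb
  obtain ⟨p₁, k₁, hk₁, hp₁⟩ := hf.2 b hb
  obtain ⟨p₂, k₂, hk₂, hp₂⟩ := hf'.2 b hb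
  refine ⟨.seq p (.cond b p₁ p₂), fun γ => k γ + (1 + (c γ).size + (k₁ γ + k₂ γ)),
    hk.add (((Bdd.const 1).add hc.1).add (hk₁.add hk₂)), fun γ s hs => ?_⟩
  obtain ⟨s', t, he, ht, hb', hj, ho⟩ := hp γ s hs
  have hs' := C.congr _ _ _ (fun j hj' => hj j (by omega)) hs
  by_cases h : c γ = 0
  · obtain ⟨s₂, t₂, he₂, ht₂, hb₂, hj₂, ho₂⟩ := hp₂ γ s' hs'
    refine ⟨s₂, _, .seq he (.condFalse (by rw [hb', h]) he₂), ?_, ?_, fun j h => ?_, ?_⟩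
    · rw [hb']; dsimp only; omega
    · simp [h, hb₂]
    · rw [hj₂ j h, hj j h]
    · simpa [ho] using ho₂
  · obtain ⟨s₂, t₂, he₂, ht₂, hb₂, hj₂, ho₂⟩ := hp₁ γ s' hs'
    refine ⟨s₂, _, .seq he (.condTrue (by rwa [hb']) he₂), ?_, ?_, fun j h => ?_, ?_⟩
    · rw [hb']; dsimp only; omega
    · simp [h, hb₂]
    · rw [hj₂ j h, hj j h]
    · simpa [ho] using ho₂

theorem Comp.of_eq {f g : Γ → ℕ} (hf : C.Comp f) (h : ∀ γ, f γ = g γ) : C.Comp g := by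
  rwa [← funext h]

section Decides

variable {P Q : Γ → Prop} [DecidablePred P] [DecidablePred Q] {f g : Γ → ℕ}

theorem Decides.ite (hP : C.Decides P) (hf : C.Comp f) (hg : C.Comp g) :
    C.Comp fun γ => if P γ then f γ else g γ :=
  (Comp.cases hP hf hg).of_eq fun γ => by by_cases h : P γ <;> simp [h]

theorem Decides.and (hP : C.Decides P) (hQ : C.Decides Q) :
    C.Decides fun γ => P γ ∧ Q γ :=
  (Comp.mul hP hQ).of_eq fun γ => by by_cases h : P γ <;> by_cases h' : Q γ <;> simp [h, h']

theorem Decides.not (hP : C.Decides P) : C.Decides fun γ => ¬ P γ :=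
  (Comp.sub (Comp.const 1) hP).of_eq fun γ => by by_cases h : P γ <;> simp [h]

theorem Comp.le (hf : C.Comp f) (hg : C.Comp g) : C.Decides fun γ => f γ ≤ g γ :=
  (Comp.cases (hf.sub hg) (Comp.const 0) (Comp.const 1)).of_eq fun γ => by
    simp [Nat.sub_eq_zero_iff_le]

theorem Comp.lt (hf : C.Comp f) (hg : C.Comp g) : C.Decides fun γ => f γ < g γ :=
  (hg.le hf).not.of_eq fun γ => by simp

theorem Comp.eq (hf : C.Comp f) (hg : C.Comp g) : C.Decides fun γ => f γ = g γ :=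
  ((hf.le hg).and (hg.le hf)).of_eq fun γ => by simp [le_antisymm_iff]

end Decides

theorem Comp.min {f g : Γ → ℕ} (hf : C.Comp f) (hg : C.Comp g) :
    C.Comp fun γ => min (f γ) (g γ) :=
  ((hf.le hg).ite hf hg).of_eq fun γ => by rw [min_def]

theorem Comp.max {f g : Γ → ℕ} (hf : C.Comp f) (hg : C.Comp g) :
    C.Comp fun γ => max (f γ) (g γ) :=
  ((hf.le hg).ite hg hf).of_eq fun γ => by rw [max_def]

/-! ### Loops, sums and products -/

/-- The invariant is indexed by the number of completed passes and forces exactly `K` of them. The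
test is made `K + 1` times, which gives the factor in the bound. -/
theorem exec_loop {x : List ℕ} {i : ℕ} {p : Prog} {K B W : ℕ} (Inv : ℕ → State → Prop)
    (hne : ∀ j < K, ∀ s, Inv j s → s.reg i ≠ 0) (hK : ∀ s, Inv K s → s.reg i = 0)
    (hW : ∀ j ≤ K, ∀ s, Inv j s → (s.reg i).size ≤ W)
    (step : ∀ j < K, ∀ s, Inv j s → ∃ s' t, Exec x p s s' t ∧ t ≤ B ∧ Inv (j + 1) s')
    {s : State} (hs : Inv 0 s) :
    ∃ s' t, Exec x (.loop i p) s s' t ∧ t ≤ (K + 1) * (1 + W + B) ∧ Inv K s' := by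
  suffices ∀ d j s, d + j = K → Inv j s →
      ∃ s' t, Exec x (.loop i p) s s' t ∧ t ≤ (d + 1) * (1 + W + B) ∧ Inv K s' from
    this K 0 s rfl hs
  intro d
  induction d with
  | zero =>
    intro j s hj hs
    obtain rfl : j = K := by omega
    refine ⟨s, _, .loopStop (hK s hs), ?_, hs⟩
    have := hW _ le_rfl s hs
    omega
  | succ d ih =>
    intro j s hj hs
    obtain ⟨s₁, t₁, he₁, ht₁, hs₁⟩ := step j (by omega) s hs
    obtain ⟨s₂, t₂, he₂, ht₂, hs₂⟩ := ih (j + 1) s₁ (by omega) hs₁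
    refine ⟨s₂, _, .loopStep (hne j (by omega) s hs) he₁ he₂, ?_, hs₂⟩
    have := hW j (by omega) s hs
    rw [add_mul (d + 1), one_mul]
    omega

/-- The length of the binary expansion can be computed by repeated halving. -/
theorem Comp.size {f : Γ → ℕ} (hf : C.Comp f) : C.Comp fun γ => (f γ).size := by
  refine ⟨hf.1.size, fun b hb => ?_⟩
  obtain ⟨p, c, hc, hp⟩ := hf.2 (b + 1) (by omega)
  refine ⟨.seq p (.seq (.const b 0) (.loop (b + 1) (.seq (.const (b + 2) 2)
      (.seq (.div (b + 1) (b + 1) (b + 2)) (.seq (.const (b + 3) 1) (.add b b (b + 3))))))),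
    fun γ => c γ + (1 + ((f γ).size + 1) * (1 + (f γ).size + (20 + 2 * (f γ).size))),
    hc.add ((Bdd.const 1).add ((hf.1.add (Bdd.const 1)).mul (((Bdd.const 1).add hf.1).add
      ((Bdd.const 20).add ((Bdd.const 2).mul hf.1))))), fun γ s hs => ?_⟩
  obtain ⟨s₁, t₁, he₁, ht₁, hb₁, hj₁, ho₁⟩ := hp γ s hs
  obtain ⟨s₂, t₂, he₂, ht₂, hi₂⟩ := exec_loop (x := enc (C.inst γ)) (i := b + 1)
    (p := .seq (.const (b + 2) 2)
      (.seq (.div (b + 1) (b + 1) (b + 2)) (.seq (.const (b + 3) 1) (.add b b (b + 3)))))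
    (K := (f γ).size) (B := 20 + 2 * (f γ).size) (W := (f γ).size)
    -- The quotient `f γ / 2 ^ j` is nonzero exactly for `j < (f γ).size`, so the number of halvings
    -- is the bit length.
    (fun j s' => s'.reg (b + 1) = f γ / 2 ^ j ∧ s'.reg b = j ∧ (∀ k < b, s'.reg k = s.reg k) ∧
      s'.out = s.out)
    (fun j hj s' hs' => by
      rw [hs'.1]
      have : 2 ^ j ≤ f γ := Nat.lt_size.1 hj
      exact (Nat.div_pos this (by positivity)).ne')
    (fun s' hs' => by rw [hs'.1]; exact Nat.div_eq_of_lt (Nat.lt_size_self _))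
    (fun j _ s' hs' => by rw [hs'.1]; exact Nat.size_le_size (Nat.div_le_self _ _))
    (fun j hj s' hs' => by
      obtain ⟨h1, h2, h3, h4⟩ := hs'
      refine ⟨_, _, .seq (.const _ _ _) (.seq (.div _ _ _ _) (.seq (.const _ _ _) (.add _ _ _ _))),
        ?_, ?_, ?_, fun k hk => ?_, ?_⟩
      · have hsz : (f γ / 2 ^ j).size ≤ (f γ).size := Nat.size_le_size (Nat.div_le_self _ _)
        have hj' : j.size ≤ j := Nat.size_le.2 Nat.lt_two_pow_self
        have e1 : Nat.size 1 = 1 := by simp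
        have e2 : Nat.size 2 = 2 := by decide
        simp only [State.setReg, Function.update, h1, h2]
        simp [e1, e2]
        omega
      · simp [State.setReg, h1, pow_succ, Nat.div_div_eq_div_mul]
      · simp [State.setReg, h2]
      · simp [State.setReg, Function.update, h3 k hk, hk.ne,
          show k ≠ b + 1 by omega, show k ≠ b + 2 by omega, show k ≠ b + 3 by omega]
      · simp [State.setReg, h4])
    (s := s₁.setReg b 0)
    ⟨by simp [State.setReg, hb₁], by simp [State.setReg], fun k hk => by
      simp [State.setReg, hk.ne, hj₁ k (by omega)], by simpa [State.setReg] using ho₁⟩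
  refine ⟨s₂, _, .seq he₁ (.seq (.const s₁ b 0) he₂), ?_, hi₂.2.1, hi₂.2.2.1, by simpa using hi₂.2.2.2⟩
  have e0 : Nat.size 0 = 0 := by simp
  dsimp only
  omega

/-- The context extended by a variable, in register `b`, that ranges over the numbers below
`cnt`. -/
def bind (C : Ctx enc Γ) (b : ℕ) (cnt : Γ → ℕ) : Ctx enc {p : Γ × ℕ // p.2 < cnt p.1} where
  inst p := C.inst p.1.1
  arity := max C.arity (b + 1)
  Holds p r := C.Holds p.1.1 r ∧ r b = p.1.2
  congr p r r' h hr := ⟨C.congr _ _ _ (fun j hj => h j (by omega)) hr.1, by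
    rw [h b (by omega), hr.2]⟩

/-- The context extended by the value of `f`, in register `b`. -/
def letv (C : Ctx enc Γ) (b : ℕ) (f : Γ → ℕ) : Ctx enc Γ where
  inst := C.inst
  arity := max C.arity (b + 1)
  Holds γ r := C.Holds γ r ∧ r b = f γ
  congr p r r' h hr := ⟨C.congr _ _ _ (fun j hj => h j (by omega)) hr.1, by
    rw [h b (by omega), hr.2]⟩

theorem bind_refines (C : Ctx enc Γ) (b : ℕ) (cnt : Γ → ℕ) :
    (C.bind b cnt).Refines C fun p => p.1.1 :=
  ⟨fun _ => rfl, le_max_left _ _, fun _ _ h => h.1⟩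

theorem letv_refines (C : Ctx enc Γ) (b : ℕ) (f : Γ → ℕ) : (C.letv b f).Refines C id :=
  ⟨fun _ => rfl, le_max_left _ _, fun _ _ h => h.1⟩

theorem Comp.up {f cnt : Γ → ℕ} {b : ℕ} (hf : C.Comp f) : (C.bind b cnt).Comp fun p => f p.1.1 :=
  hf.weaken (bind_refines _ _ _)

theorem Comp.up' {f g : Γ → ℕ} {b : ℕ} (hf : C.Comp f) : (C.letv b g).Comp f :=
  hf.weaken (letv_refines _ _ _)

theorem Bdd.up {f cnt : Γ → ℕ} {b : ℕ} (hf : C.Bdd f) : (C.bind b cnt).Bdd fun p => f p.1.1 :=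
  hf.comp (bind_refines _ _ _)

theorem Bdd.bound {cnt : Γ → ℕ} {b : ℕ} (hc : C.Bdd cnt) : (C.bind b cnt).Bdd fun p => p.1.2 :=
  hc.up.of_le fun p => p.2.le

theorem Comp.bound {cnt : Γ → ℕ} {b : ℕ} (hc : C.Bdd cnt) : (C.bind b cnt).Comp fun p => p.1.2 :=
  .ofReg b (fun _ _ h => h.2) hc.bound.size

theorem Comp.letvar {f : Γ → ℕ} {b : ℕ} (hf : C.Bdd fun γ => (f γ).size) : (C.letv b f).Comp f :=
  .ofReg b (fun _ _ h => h.2) hf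

/-- A loop with an accumulator that runs through `F γ 0, F γ 1, …, F γ (cnt γ)` and with output
`g γ 0, g γ 1, …`. -/
theorem Does.iter {F : Γ → ℕ → ℕ} {g : Γ → ℕ → List ℕ} {cnt W : Γ → ℕ} (hcnt : C.Comp cnt)
    (hcb : C.Bdd cnt) (hW : C.Bdd W) (hF : ∀ γ, ∀ j ≤ cnt γ, (F γ j).size ≤ W γ)
    (h0 : C.Comp fun γ => F γ 0)
    (hstep : ∀ b, ((C.bind (b + 1) cnt).letv b fun p => F p.1.1 p.1.2).Does
      (fun p => F p.1.1 (p.1.2 + 1)) fun p => g p.1.1 p.1.2) :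
    C.Does (fun γ => F γ (cnt γ)) fun γ => (List.range (cnt γ)).flatMap (g γ) := by
  refine ⟨hW.of_le fun γ => hF γ _ le_rfl, fun b hb => ?_⟩
  obtain ⟨p₀, c₀, hc₀, hp₀⟩ := h0.2 b hb
  obtain ⟨p₁, c₁, hc₁, hp₁⟩ := hcnt.2 (b + 2) (by omega)
  obtain ⟨p₂, c₂, ⟨q, hq⟩, hp₂⟩ := (hstep b).2 (b + 4) (by simp only [letv, bind]; omega)
  -- Register `b` holds the accumulator, `b + 1` the index, `b + 2` the number of remaining passes,
  -- `b + 3` the constant 1, and `b + 4` the new accumulator value.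
  set body : Prog := .seq p₂ (.seq (.copy b (b + 4)) (.seq (.const (b + 3) 1)
    (.seq (.add (b + 1) (b + 1) (b + 3)) (.sub (b + 2) (b + 2) (b + 3))))) with hbody
  refine ⟨.seq p₀ (.seq p₁ (.seq (.const (b + 1) 0) (.loop (b + 2) body))),
    fun γ => c₀ γ + (c₁ γ + (1 + (cnt γ + 1) * (1 + cnt γ + (q.eval (C.len γ) +
      (20 + W γ + 2 * cnt γ))))), ?_, fun γ s hs => ?_⟩
  · have hq' : C.Bdd fun γ => q.eval (C.len γ) := ⟨q, fun _ => le_rfl⟩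
    exact hc₀.add (hc₁.add ((Bdd.const 1).add ((hcb.add (Bdd.const 1)).mul
      (((Bdd.const 1).add hcb).add (hq'.add (((Bdd.const 20).add hW).add
        ((Bdd.const 2).mul hcb)))))))
  obtain ⟨s₁, t₁, he₁, ht₁, hb₁, hj₁, ho₁⟩ := hp₀ γ s hs
  obtain ⟨s₂, t₂, he₂, ht₂, hb₂, hj₂, ho₂⟩ :=
    hp₁ γ s₁ (C.congr _ _ _ (fun j hj => hj₁ j (by omega)) hs)
  have e1 : Nat.size 1 = 1 := by simp
  have e0 : Nat.size 0 = 0 := by simp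
  have hsz : ∀ k : ℕ, k.size ≤ k := fun k => Nat.size_le.2 Nat.lt_two_pow_self
  obtain ⟨s₃, t₃, he₃, ht₃, hi₃⟩ := exec_loop (x := enc (C.inst γ)) (i := b + 2)
    (p := body) (K := cnt γ) (W := cnt γ) (B := q.eval (C.len γ) + (20 + W γ + 2 * cnt γ))
    (fun j s' => s'.reg b = F γ j ∧ s'.reg (b + 1) = j ∧ s'.reg (b + 2) = cnt γ - j ∧
      (∀ k < b, s'.reg k = s.reg k) ∧ s'.out = s.out ++ (List.range j).flatMap (g γ))
    (fun j hj s' hs' => by rw [hs'.2.2.1]; omega)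
    (fun s' hs' => by rw [hs'.2.2.1]; omega)
    (fun j _ s' hs' => by rw [hs'.2.2.1]; have := hsz (cnt γ - j); omega)
    (fun j hj s' hs' => by
      obtain ⟨h1, h2, h3, h4, h5⟩ := hs'
      obtain ⟨s₄, t₄, he₄, ht₄, hb₄, hj₄, ho₄⟩ := hp₂ ⟨(γ, j), hj⟩ s'
        ⟨⟨C.congr _ _ _ (fun k hk => h4 k (by omega)) hs, h2⟩, h1⟩
      have hb' : s₄.reg (b + 1) = j := by rw [hj₄ _ (by omega), h2]
      have hb'' : s₄.reg (b + 2) = cnt γ - j := by rw [hj₄ _ (by omega), h3]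
      dsimp only at hb₄ ho₄
      refine ⟨_, _, .seq he₄ (.seq (.copy _ _ _) (.seq (.const _ _ _)
        (.seq (.add _ _ _ _) (.sub _ _ _ _)))), ?_, ?_, ?_, ?_, fun k hk => ?_, ?_⟩
      · have hq₄ : c₂ ⟨(γ, j), hj⟩ ≤ q.eval (C.len γ) := hq ⟨(γ, j), hj⟩
        have hFj := hF γ (j + 1) hj
        have hs1 := hsz j
        have hs2 := hsz (cnt γ - j)
        simp [State.setReg, Function.update, e1, hb₄, hb', hb'']
        omega
      · simp [State.setReg, hb₄]
      · simp [State.setReg, hb']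
      · simp [State.setReg, hb'']; omega
      · simp [State.setReg, Function.update, hk.ne, show k ≠ b + 1 by omega,
          show k ≠ b + 2 by omega, show k ≠ b + 3 by omega, hj₄ k (by omega), h4 k hk]
      · simp [State.setReg, ho₄, h5, List.range_succ])
    (s := s₂.setReg (b + 1) 0)
    ⟨by simp [State.setReg, hj₂, hb₁], by simp [State.setReg], by simp [State.setReg, hb₂],
      fun k hk => by
        simp [State.setReg, show k ≠ b + 1 by omega, hj₂ k (by omega), hj₁ k hk],
      by simp [State.setReg, ho₂, ho₁]⟩
  refine ⟨s₃, _, .seq he₁ (.seq he₂ (.seq (.const s₂ (b + 1) 0) he₃)), ?_, hi₃.1, hi₃.2.2.2.1,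
    hi₃.2.2.2.2⟩
  dsimp only
  omega

theorem Comp.iter {F : Γ → ℕ → ℕ} {cnt W : Γ → ℕ} (hcnt : C.Comp cnt)
    (hb : C.Bdd cnt) (hW : C.Bdd W) (hF : ∀ γ, ∀ j ≤ cnt γ, (F γ j).size ≤ W γ)
    (h0 : C.Comp fun γ => F γ 0)
    (hstep : ∀ b, ((C.bind (b + 1) cnt).letv b fun p => F p.1.1 p.1.2).Comp
      (fun p => F p.1.1 (p.1.2 + 1))) :
    C.Comp (fun γ => F γ (cnt γ)) := by
  have := Does.iter (g := fun _ _ => []) hcnt hb hW hF h0 hstep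
  have h : (fun γ => (List.range (cnt γ)).flatMap fun _ => ([] : List ℕ)) = fun _ => [] :=
    funext fun γ => by simp [List.flatMap_eq_nil_iff]
  rwa [h] at this

theorem size_sum_le (f : ℕ → ℕ) (k w : ℕ) (h : ∀ j < k, (f j).size ≤ w) :
    (∑ j ∈ Finset.range k, f j).size ≤ k + w := by
  rw [Nat.size_le, pow_add]
  calc ∑ j ∈ Finset.range k, f j ≤ ∑ j ∈ Finset.range k, 2 ^ w :=
        Finset.sum_le_sum fun j hj => (Nat.size_le.1 (h j (Finset.mem_range.1 hj))).le
    _ = k * 2 ^ w := by simp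
    _ < 2 ^ k * 2 ^ w := Nat.mul_lt_mul_of_pos_right Nat.lt_two_pow_self (by positivity)

theorem size_prod_le (f : ℕ → ℕ) (k w : ℕ) (h : ∀ j < k, (f j).size ≤ w) :
    (∏ j ∈ Finset.range k, f j).size ≤ k * w + 1 := by
  induction k with
  | zero => simp
  | succ k ih =>
    rw [Finset.prod_range_succ]
    have h1 := ih fun j hj => h j (by omega)
    have h2 := h k (by omega)
    have := size_mul_le (∏ j ∈ Finset.range k, f j) (f k)
    rw [add_mul, one_mul]
    omega

theorem Comp.sum {f : Γ → ℕ → ℕ} {cnt : Γ → ℕ} (hcnt : C.Comp cnt) (hb : C.Bdd cnt)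
    (hf : ∀ b, (C.bind b cnt).Comp fun p => f p.1.1 p.1.2) :
    C.Comp fun γ => ∑ j ∈ Finset.range (cnt γ), f γ j := by
  obtain ⟨q, hq⟩ := (hf 0).1
  have hW : ∀ γ, ∀ k ≤ cnt γ, (∑ j ∈ Finset.range k, f γ j).size ≤ cnt γ + q.eval (C.len γ) :=
    fun γ k hk => (size_sum_le _ _ _ fun j hj => hq ⟨(γ, j), by simp; omega⟩).trans
      (Nat.add_le_add_right hk _)
  have hW' : C.Bdd fun γ => cnt γ + q.eval (C.len γ) := hb.add ⟨q, fun _ => le_rfl⟩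
  refine Comp.iter (F := fun γ k => ∑ j ∈ Finset.range k, f γ j) hcnt hb hW' hW
    (by simpa using Comp.const 0) fun b => ?_
  simp only [Finset.sum_range_succ]
  refine Comp.add (.letvar ?_) (hf _).up'
  exact hW'.up.of_le fun p => hW _ _ p.2.le

theorem Comp.prod {f : Γ → ℕ → ℕ} {cnt : Γ → ℕ} (hcnt : C.Comp cnt) (hb : C.Bdd cnt)
    (hf : ∀ b, (C.bind b cnt).Comp fun p => f p.1.1 p.1.2) :
    C.Comp fun γ => ∏ j ∈ Finset.range (cnt γ), f γ j := by
  obtain ⟨q, hq⟩ := (hf 0).1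
  have hW : ∀ γ, ∀ k ≤ cnt γ,
      (∏ j ∈ Finset.range k, f γ j).size ≤ cnt γ * q.eval (C.len γ) + 1 :=
    fun γ k hk => (size_prod_le _ _ _ fun j hj => hq ⟨(γ, j), by simp; omega⟩).trans
      (Nat.add_le_add_right (Nat.mul_le_mul_right _ hk) _)
  have hW' : C.Bdd fun γ => cnt γ * q.eval (C.len γ) + 1 :=
    (hb.mul ⟨q, fun _ => le_rfl⟩).add (Bdd.const 1)
  refine Comp.iter (F := fun γ k => ∏ j ∈ Finset.range k, f γ j) hcnt hb hW' hW
    (by simpa using Comp.const 1) fun b => ?_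
  simp only [Finset.prod_range_succ]
  refine Comp.mul (.letvar ?_) (hf _).up'
  exact hW'.up.of_le fun p => hW _ _ p.2.le

theorem Comp.two_pow {f : Γ → ℕ} (hf : C.Comp f) (hb : C.Bdd f) : C.Comp fun γ => 2 ^ f γ :=
  (Comp.prod (f := fun _ _ => 2) hf hb fun _ => .const 2).of_eq fun γ => by simp

/-! ### Writing output -/

theorem Does.seq {f f' : Γ → ℕ} {g g' : Γ → List ℕ} (h : C.Does f g) (h' : C.Does f' g') :
    C.Does f' fun γ => g γ ++ g' γ := by
  refine ⟨h'.1, fun b hb => ?_⟩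
  obtain ⟨p, c, hc, hp⟩ := h.2 b hb
  obtain ⟨p', c', hc', hp'⟩ := h'.2 b hb
  refine ⟨.seq p p', fun γ => c γ + c' γ, hc.add hc', fun γ s hs => ?_⟩
  obtain ⟨s₁, t₁, he₁, ht₁, hb₁, hj₁, ho₁⟩ := hp γ s hs
  obtain ⟨s₂, t₂, he₂, ht₂, hb₂, hj₂, ho₂⟩ :=
    hp' γ s₁ (C.congr _ _ _ (fun j hj => hj₁ j (by omega)) hs)
  exact ⟨s₂, _, .seq he₁ he₂, add_le_add ht₁ ht₂, hb₂,
    fun j hj => by rw [hj₂ j hj, hj₁ j hj], by simp [ho₂, ho₁]⟩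

theorem Comp.write {f : Γ → ℕ} (hf : C.Comp f) : C.Does f fun γ => [f γ] := by
  refine ⟨hf.1, fun b hb => ?_⟩
  obtain ⟨p, c, hc, hp⟩ := hf.2 b hb
  refine ⟨.seq p (.write b), fun γ => c γ + (1 + (f γ).size), hc.add ((Bdd.const 1).add hf.1),
    fun γ s hs => ?_⟩
  obtain ⟨s₁, t₁, he₁, ht₁, hb₁, hj₁, ho₁⟩ := hp γ s hs
  exact ⟨_, _, .seq he₁ (.write s₁ b), by rw [hb₁]; dsimp only; omega, hb₁, hj₁, by simp [ho₁, hb₁]⟩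

theorem Does.returning {f f' : Γ → ℕ} {g : Γ → List ℕ} (h : C.Does f g) (hf : C.Comp f') :
    C.Does f' g := by
  simpa using h.seq hf

theorem Does.emits {f : Γ → ℕ} {g : Γ → List ℕ} (h : C.Does f g) : C.Emits g :=
  h.returning (.const 0)

theorem Emits.map {f : Γ → ℕ → ℕ} {cnt : Γ → ℕ} (hcnt : C.Comp cnt) (hb : C.Bdd cnt)
    (hf : ∀ b, (C.bind b cnt).Comp fun p => f p.1.1 p.1.2) :
    C.Emits fun γ => (List.range (cnt γ)).map (f γ) := by
  have := Does.iter (C := C) (F := fun _ _ => 0) (g := fun γ j => [f γ j]) (W := fun _ => 0) hcnt hb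
    (Bdd.const 0) (fun _ _ _ => by simp) (Comp.const 0)
    fun b => ((hf (b + 1)).up'.write.emits)
  simpa only [Emits, ← List.map_eq_flatMap] using this

end Ctx

/-- The context in which nothing but the instance is known. -/
def Ctx.base (enc : α → List ℕ) : Ctx enc α where
  inst := id
  arity := 0
  Holds _ _ := True
  congr _ _ _ _ _ := trivial

/-- The cost bound holds on all instances; the promise `dom` is needed only for the correctness of
the output. -/
theorem solvableInPolyTime_of_emits {dom : Set α} {good : α → List ℕ → Prop} {g : α → List ℕ}
    (hg : (Ctx.base enc).Emits g) (h : ∀ a ∈ dom, good a (g a)) :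
    SolvableInPolyTime enc dom good := by
  obtain ⟨p, c, ⟨q, hq⟩, hp⟩ := hg.2 0 le_rfl
  refine ⟨p, q, fun a ha => ?_⟩
  obtain ⟨s', t, he, ht, -, -, ho⟩ := hp a State.init trivial
  refine ⟨s', t, he, ht.trans (hq a), ?_⟩
  rw [ho]
  simpa [State.init] using h a ha

end Framework

end RAM

namespace RepeatedMatching

open RAM

/-! ### The algorithm -/

section Algorithm

variable (I : RepeatedMatching)

/-- The numerator of the value of agent `i` for good `g`, as read from the input. -/
def num (i g : ℕ) : ℕ := I.encode.getD (3 + 2 * (i * I.m + g)) 0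

/-- The denominator of the value of agent `i` for good `g`, as read from the input. -/
def den (i g : ℕ) : ℕ := I.encode.getD (4 + 2 * (i * I.m + g)) 0

/-- The number of agents that distinguish good `g` from good `0`. -/
def distinguishers (g : ℕ) : ℕ :=
  ∑ i ∈ Finset.range I.n, if I.num i g = I.num i 0 ∧ I.den i g = I.den i 0 then 0 else 1

/-- The type of good `g`: it is `0` if all agents value `g` like good `0`, and `1` otherwise. -/
def kind (g : ℕ) : ℕ := if I.distinguishers g = 0 then 0 else 1

/-- The number of goods of type `r` among the first `k` goods. -/
def kindCount (r k : ℕ) : ℕ := ∑ g ∈ Finset.range k, if I.kind g = r then 1 else 0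

/-- The good of type `r` that is preceded by `k` goods of type `r`. -/
def nthGood (r k : ℕ) : ℕ :=
  ∑ g ∈ Finset.range I.m, if I.kindCount r (g + 1) ≤ k then 1 else 0

/-- The least number of agents that get a good of type `1` in a matching. -/
def minOnes : ℕ := I.n - I.kindCount 0 I.m

/-- The largest number of agents that get a good of type `1` in a matching. -/
def maxOnes : ℕ := min I.n (I.kindCount 1 I.m)

/-- A good of type `1`, if there is one. -/
def otherGood : ℕ := I.nthGood 1 0 % I.m

/-- A common denominator of all values. -/
def scale : ℕ := ∏ i ∈ Finset.range I.n, I.den i 0 * I.den i I.otherGood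

/-- The scaled value of agent `i` for the goods of type `0`. -/
def valZero (i : ℕ) : ℕ := I.num i 0 * (I.scale / I.den i 0)

/-- The scaled value of agent `i` for the goods of type `1`. -/
def valOne (i : ℕ) : ℕ := I.num i I.otherGood * (I.scale / I.den i I.otherGood)

/-- The least number of goods of type `1` with which agent `i` reaches the target `v`. -/
def lower (v i : ℕ) : ℕ :=
  if I.valZero i < I.valOne i then
    (v - I.valZero i * I.T + (I.valOne i - I.valZero i) - 1) / (I.valOne i - I.valZero i)
  else 0

/-- The largest number of goods of type `1` with which agent `i` reaches the target `v`. -/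
def upper (v i : ℕ) : ℕ :=
  if I.valOne i < I.valZero i then
    min I.T ((I.valZero i * I.T - v) / (I.valZero i - I.valOne i))
  else I.T

def lowers (v i : ℕ) : ℕ := ∑ j ∈ Finset.range i, I.lower v j

def uppers (v i : ℕ) : ℕ := ∑ j ∈ Finset.range i, I.upper v j

/-- The number of agents for which the target `v` is too large. -/
def hopeless (v : ℕ) : ℕ :=
  ∑ i ∈ Finset.range I.n, if v ≤ max (I.valZero i) (I.valOne i) * I.T then 0 else 1

/-- All agents can reach the (scaled) target `v`. -/
def Feasible (v : ℕ) : Prop :=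
  I.hopeless v = 0 ∧ I.lowers v I.n ≤ I.T * I.maxOnes ∧ I.T * I.minOnes ≤ I.uppers v I.n

instance : DecidablePred I.Feasible := fun _ => inferInstanceAs (Decidable (_ ∧ _))

/-- The number of bits of a bound on the feasible targets. -/
def bits : ℕ := (max (I.valZero 0) (I.valOne 0) * I.T).size

/-- Binary search for the largest feasible target, from the highest bit on. -/
def search : ℕ → ℕ
  | 0 => 0
  | j + 1 => if I.Feasible (search j + 2 ^ (I.bits - (j + 1))) then
      search j + 2 ^ (I.bits - (j + 1)) else search j

/-- The largest feasible target. -/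
def target : ℕ := I.search I.bits

/-- The number of goods of type `1` that the agents before agent `i` get, if the target is `v`. -/
def cutFor (v i : ℕ) : ℕ :=
  min (I.lowers v i + (I.T * I.minOnes - I.lowers v I.n)) (I.uppers v i)

/-- The number of goods of type `1` that the agents before agent `i` get. -/
def cut (i : ℕ) : ℕ := I.cutFor I.target i

/-- The round at which `(cut i + t) / T` increases. -/
def breakpoint (i : ℕ) : ℕ := I.T - I.cut i % I.T

/-- The first of `T` and `breakpoint 0`, …, `breakpoint (k - 1)` after round `t`. -/
def nextBreak (t : ℕ) : ℕ → ℕ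
  | 0 => I.T
  | k + 1 => if t < I.breakpoint k ∧ I.breakpoint k < nextBreak t k then I.breakpoint k
      else nextBreak t k

/-- The first round of block `j`. -/
def start : ℕ → ℕ
  | 0 => 0
  | j + 1 => I.nextBreak (start j) (I.n + 1)

/-- The number of agents before agent `i` that get a good of type `1` in round `t`. -/
def onesBefore (t i : ℕ) : ℕ := (I.cut i + t) / I.T

/-- The good that agent `i` gets in round `t`. -/
def goodAt (t i : ℕ) : ℕ :=
  if I.onesBefore t i = I.onesBefore t (i + 1) then I.nthGood 0 (i - I.onesBefore t i)
  else I.nthGood 1 (I.onesBefore t i)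

/-- The output of the algorithm. -/
def output : List ℕ :=
  (List.range (I.n + 1)).flatMap fun j =>
    [I.start (j + 1) - I.start j] ++ (List.range I.n).map (I.goodAt (I.start j % I.T))

end Algorithm

/-! ### Running time -/

section RunningTime

variable {Γ : Type} {C : Ctx encode Γ} {i g r k v t : Γ → ℕ}

theorem length_encode (I : RepeatedMatching) : I.encode.length = 3 + I.n * (I.m * 2) := by
  simp [encode, List.length_flatMap]
  ring

theorem length_le_inputSize (x : List ℕ) : x.length ≤ inputSize x := by
  unfold inputSize
  induction x with
  | nil => simp
  | cons a x ih => simp; omega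

open Ctx

/-- The input lists `2 * n * m` numerators and denominators and `n ≥ 1`, so the number of goods
itself, not just its bit length, is polynomial. -/
theorem bdd_m : C.Bdd fun γ => (C.inst γ).m := Bdd.len.of_le fun γ => by
  refine le_trans ?_ (length_le_inputSize _)
  rw [length_encode]
  nlinarith [(C.inst γ).n_pos]

theorem bdd_n : C.Bdd fun γ => (C.inst γ).n := bdd_m.of_le fun γ => (C.inst γ).n_le_m

theorem comp_n : C.Comp fun γ => (C.inst γ).n :=
  (Comp.input (.const 0)).of_eq fun _ => rfl

theorem comp_m : C.Comp fun γ => (C.inst γ).m :=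
  (Comp.input (.const 1)).of_eq fun _ => rfl

theorem comp_T : C.Comp fun γ => (C.inst γ).T :=
  (Comp.input (.const 2)).of_eq fun _ => rfl

theorem comp_num (hi : C.Comp i) (hg : C.Comp g) :
    C.Comp fun γ => (C.inst γ).num (i γ) (g γ) :=
  ((Comp.const 3).add ((Comp.const 2).mul ((hi.mul comp_m).add hg))).input

theorem comp_den (hi : C.Comp i) (hg : C.Comp g) :
    C.Comp fun γ => (C.inst γ).den (i γ) (g γ) :=
  ((Comp.const 4).add ((Comp.const 2).mul ((hi.mul comp_m).add hg))).input

theorem comp_kind (hg : C.Comp g) : C.Comp fun γ => (C.inst γ).kind (g γ) := by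
  refine Decides.ite (.eq (.sum comp_n bdd_n fun b => ?_) (.const 0)) (.const 0) (.const 1)
  have hi := Comp.bound (b := b) (bdd_n (C := C))
  exact (((comp_num hi hg.up).eq (comp_num hi (.const 0))).and
    ((comp_den hi hg.up).eq (comp_den hi (.const 0)))).ite (.const 0) (.const 1)

theorem comp_kindCount (hr : C.Comp r) (hk : C.Comp k) (hb : C.Bdd k) :
    C.Comp fun γ => (C.inst γ).kindCount (r γ) (k γ) :=
  .sum hk hb fun _ => ((comp_kind (.bound hb)).eq hr.up).ite (.const 1) (.const 0)

theorem comp_nthGood (hr : C.Comp r) (hk : C.Comp k) :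
    C.Comp fun γ => (C.inst γ).nthGood (r γ) (k γ) :=
  .sum comp_m bdd_m fun _ => ((comp_kindCount hr.up ((Comp.bound bdd_m).add (.const 1))
    ((Bdd.bound bdd_m).add (.const 1))).le hk.up).ite (.const 1) (.const 0)

theorem comp_minOnes : C.Comp fun γ => (C.inst γ).minOnes :=
  comp_n.sub (comp_kindCount (.const 0) comp_m bdd_m)

theorem comp_maxOnes : C.Comp fun γ => (C.inst γ).maxOnes :=
  comp_n.min (comp_kindCount (.const 1) comp_m bdd_m)

theorem comp_otherGood : C.Comp fun γ => (C.inst γ).otherGood :=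
  (comp_nthGood (.const 1) (.const 0)).mod comp_m

theorem comp_scale : C.Comp fun γ => (C.inst γ).scale :=
  .prod comp_n bdd_n fun _ => (comp_den (.bound bdd_n) (.const 0)).mul
    (comp_den (.bound bdd_n) comp_otherGood)

theorem comp_valZero (hi : C.Comp i) : C.Comp fun γ => (C.inst γ).valZero (i γ) :=
  (comp_num hi (.const 0)).mul (comp_scale.div (comp_den hi (.const 0)))

theorem comp_valOne (hi : C.Comp i) : C.Comp fun γ => (C.inst γ).valOne (i γ) :=
  (comp_num hi comp_otherGood).mul (comp_scale.div (comp_den hi comp_otherGood))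

theorem comp_lower (hv : C.Comp v) (hi : C.Comp i) :
    C.Comp fun γ => (C.inst γ).lower (v γ) (i γ) :=
  have ha := comp_valZero hi
  have hb := comp_valOne hi
  (ha.lt hb).ite ((((hv.sub (ha.mul comp_T)).add (hb.sub ha)).sub (.const 1)).div (hb.sub ha))
    (.const 0)

theorem comp_upper (hv : C.Comp v) (hi : C.Comp i) :
    C.Comp fun γ => (C.inst γ).upper (v γ) (i γ) :=
  have ha := comp_valZero hi
  have hb := comp_valOne hi
  (hb.lt ha).ite (comp_T.min (((ha.mul comp_T).sub hv).div (ha.sub hb))) comp_T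

theorem comp_lowers (hv : C.Comp v) (hi : C.Comp i) (hb : C.Bdd i) :
    C.Comp fun γ => (C.inst γ).lowers (v γ) (i γ) :=
  .sum hi hb fun _ => comp_lower hv.up (.bound hb)

theorem comp_uppers (hv : C.Comp v) (hi : C.Comp i) (hb : C.Bdd i) :
    C.Comp fun γ => (C.inst γ).uppers (v γ) (i γ) :=
  .sum hi hb fun _ => comp_upper hv.up (.bound hb)

theorem comp_hopeless (hv : C.Comp v) : C.Comp fun γ => (C.inst γ).hopeless (v γ) :=
  .sum comp_n bdd_n fun _ => (hv.up.le (((comp_valZero (.bound bdd_n)).max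
    (comp_valOne (.bound bdd_n))).mul comp_T)).ite (.const 0) (.const 1)

theorem decides_feasible (hv : C.Comp v) : C.Decides fun γ => (C.inst γ).Feasible (v γ) :=
  Comp.of_eq (((comp_hopeless hv).eq (.const 0)).and
    (((comp_lowers hv comp_n bdd_n).le (comp_T.mul comp_maxOnes)).and
    ((comp_T.mul comp_minOnes).le (comp_uppers hv comp_n bdd_n)))) fun _ =>
      if_congr Iff.rfl rfl rfl

theorem comp_bound : C.Comp fun γ =>
    max ((C.inst γ).valZero 0) ((C.inst γ).valOne 0) * (C.inst γ).T :=
  ((comp_valZero (.const 0)).max (comp_valOne (.const 0))).mul comp_T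

theorem bdd_bits : C.Bdd fun γ => (C.inst γ).bits := comp_bound.bdd

theorem comp_bits : C.Comp fun γ => (C.inst γ).bits := comp_bound.size

/-- After `j` steps only the top `j` of `bits` bits have been decided, which keeps the accumulator
of the search short. -/
theorem search_add_le (I : RepeatedMatching) (j : ℕ) (hj : j ≤ I.bits) :
    I.search j + 2 ^ (I.bits - j) ≤ 2 ^ I.bits := by
  induction j with
  | zero => simp [search]
  | succ j ih =>
    have h : 2 ^ (I.bits - j) = 2 ^ (I.bits - (j + 1)) + 2 ^ (I.bits - (j + 1)) := by
      rw [← two_mul, ← pow_succ']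
      congr 1
      omega
    have := ih (by omega)
    have : 0 < 2 ^ (I.bits - (j + 1)) := by positivity
    simp only [search]
    split_ifs <;> omega

theorem size_search_le (I : RepeatedMatching) (j : ℕ) (hj : j ≤ I.bits) :
    (I.search j).size ≤ I.bits := by
  rw [Nat.size_le]
  have := I.search_add_le j hj
  have : 0 < 2 ^ (I.bits - j) := by positivity
  omega

theorem comp_target : C.Comp fun γ => (C.inst γ).target := by
  refine Comp.iter (F := fun γ j => (C.inst γ).search j) comp_bits bdd_bits bdd_bits
    (fun γ j hj => size_search_le _ j hj) (.const 0) fun b => ?_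
  have hs : ((C.bind (b + 1) fun γ => (C.inst γ).bits).letv b fun p =>
      (C.inst p.1.1).search p.1.2).Comp fun p => (C.inst p.1.1).search p.1.2 :=
    .letvar (bdd_bits.up.of_le fun p => size_search_le _ _ p.2.le)
  have hj : ((C.bind (b + 1) fun γ => (C.inst γ).bits).letv b fun p =>
      (C.inst p.1.1).search p.1.2).Comp fun p => p.1.2 := (Comp.bound bdd_bits).up'
  have hw := hs.add (Comp.two_pow ((comp_bits.sub (hj.add (.const 1)))) (bdd_bits.of_le
    fun _ => Nat.sub_le _ _))
  exact (decides_feasible hw).ite hw hs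

theorem comp_cut (hi : C.Comp i) (hb : C.Bdd i) : C.Comp fun γ => (C.inst γ).cut (i γ) :=
  ((comp_lowers comp_target hi hb).add ((comp_T.mul comp_minOnes).sub
    (comp_lowers comp_target comp_n bdd_n))).min (comp_uppers comp_target hi hb)

theorem comp_breakpoint (hi : C.Comp i) (hb : C.Bdd i) :
    C.Comp fun γ => (C.inst γ).breakpoint (i γ) :=
  comp_T.sub ((comp_cut hi hb).mod comp_T)

theorem nextBreak_le (I : RepeatedMatching) (t k : ℕ) : I.nextBreak t k ≤ I.T := by
  induction k with
  | zero => exact le_rfl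
  | succ k ih =>
    simp only [nextBreak]
    split_ifs <;> omega

theorem start_le (I : RepeatedMatching) (j : ℕ) : I.start j ≤ I.T := by
  cases j with
  | zero => exact Nat.zero_le _
  | succ j => exact nextBreak_le _ _ _

theorem comp_nextBreak (ht : C.Comp t) (hk : C.Comp k) (hb : C.Bdd k) :
    C.Comp fun γ => (C.inst γ).nextBreak (t γ) (k γ) := by
  refine Comp.iter (F := fun γ j => (C.inst γ).nextBreak (t γ) j) hk hb comp_T.bdd
    (fun γ j hj => Nat.size_le_size (nextBreak_le _ _ _)) comp_T fun b => ?_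
  have hs : ((C.bind (b + 1) k).letv b fun p => (C.inst p.1.1).nextBreak (t p.1.1) p.1.2).Comp
      fun p => (C.inst p.1.1).nextBreak (t p.1.1) p.1.2 :=
    .letvar (comp_T.bdd.up.of_le fun p => Nat.size_le_size (nextBreak_le _ _ _))
  have hp := comp_breakpoint (C := ((C.bind (b + 1) k).letv b fun p =>
    (C.inst p.1.1).nextBreak (t p.1.1) p.1.2)) (Comp.bound hb).up'
    ((Bdd.bound hb).comp (letv_refines _ _ _))
  exact ((ht.up.up'.lt hp).and (hp.lt hs)).ite hp hs

theorem comp_onesBefore (ht : C.Comp t) (hi : C.Comp i) (hb : C.Bdd i) :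
    C.Comp fun γ => (C.inst γ).onesBefore (t γ) (i γ) :=
  ((comp_cut hi hb).add ht).div comp_T

theorem comp_goodAt (ht : C.Comp t) (hi : C.Comp i) (hb : C.Bdd i) :
    C.Comp fun γ => (C.inst γ).goodAt (t γ) (i γ) :=
  have hq := comp_onesBefore ht hi hb
  (hq.eq (comp_onesBefore ht (hi.add (.const 1)) (hb.add (.const 1)))).ite
    (comp_nthGood (.const 0) (hi.sub hq)) (comp_nthGood (.const 1) hq)

/-- The accumulator carries `start j`, so each block is found from the previous one. -/
theorem emits_output : C.Emits fun γ => (C.inst γ).output := by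
  have hb : C.Bdd fun γ => (C.inst γ).n + 1 := bdd_n.add (.const 1)
  refine (Does.iter (F := fun γ j => (C.inst γ).start j) (comp_n.add (.const 1))
    hb comp_T.bdd (fun γ j _ => Nat.size_le_size (start_le _ j)) (.const 0)
    fun b => ?_).emits
  set C' := (C.bind (b + 1) fun γ => (C.inst γ).n + 1).letv b fun p => (C.inst p.1.1).start p.1.2
  have hs : C'.Comp fun p => (C.inst p.1.1).start p.1.2 :=
    .letvar (comp_T.bdd.up.of_le fun p => Nat.size_le_size (start_le _ _))
  have hn : C'.Comp fun p => (C.inst p.1.1).start (p.1.2 + 1) :=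
    comp_nextBreak (C := C') hs (comp_n.add (.const 1)) (bdd_n.add (.const 1))
  have hm : C'.Emits fun p => (List.range (C'.inst p).n).map
      ((C'.inst p).goodAt ((C'.inst p).start p.1.2 % (C'.inst p).T)) :=
    Emits.map (f := fun p i => (C'.inst p).goodAt ((C'.inst p).start p.1.2 % (C'.inst p).T) i)
      comp_n bdd_n fun _ => comp_goodAt (hs.mod (comp_T (C := C'))).up (.bound bdd_n)
        (.bound bdd_n)
  exact (hn.sub hs).write.seq (hm.returning hn)

end RunningTime

end RepeatedMatching

namespace RepeatedMatching

/-! ### Reading the input -/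

section Correctness

variable (I : RepeatedMatching)

theorem getD_flatMap {β : Type*} (l : List β) (f : β → List ℕ) (c : ℕ)
    (hf : ∀ b, (f b).length = c) (i r : ℕ) (hi : i < l.length) (hr : r < c) :
    (l.flatMap f).getD (i * c + r) 0 = (f l[i]).getD r 0 := by
  induction l generalizing i with
  | nil => simp at hi
  | cons b l ih =>
    rw [List.flatMap_cons]
    cases i with
    | zero =>
      rw [List.getD_append _ _ _ _ (by rw [hf]; omega)]
      simp
    | succ i =>
      rw [List.getD_append_right _ _ _ _ (by rw [hf, add_mul]; omega), hf,
        show (i + 1) * c + r - c = i * c + r by rw [add_mul]; omega, ih i (by simpa using hi)]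
      simp

theorem getD_encode (i : Fin I.n) (g : Fin I.m) (e : ℕ) (he : e < 2) :
    I.encode.getD (3 + e + 2 * (i * I.m + g)) 0 = [(I.u i g).num, (I.u i g).den].getD e 0 := by
  have h : 3 + e + 2 * (i * I.m + g) = (i * (I.m * 2) + (g * 2 + e)) + 3 := by ring
  have hg := g.2
  rw [h]
  simp only [encode, List.getD_cons_succ]
  rw [getD_flatMap _ _ (I.m * 2) (by simp [List.length_flatMap]) _ _ (by simp) (by omega),
    getD_flatMap _ _ 2 (by simp) _ _ (by simp) he]
  simp

theorem num_eq (i : Fin I.n) (g : Fin I.m) : I.num i g = (I.u i g).num :=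
  I.getD_encode i g 0 (by norm_num)

theorem den_eq (i : Fin I.n) (g : Fin I.m) : I.den i g = (I.u i g).den :=
  I.getD_encode i g 1 (by norm_num)

/-! ### Types of goods -/

theorem m_pos : 0 < I.m := I.n_pos.trans_le I.n_le_m

theorem kind_eq_zero_iff (g : Fin I.m) : I.kind g = 0 ↔ ∀ i, I.u i g = I.u i ⟨0, I.m_pos⟩ := by
  have h0 : ∀ i : Fin I.n, I.num i 0 = (I.u i ⟨0, I.m_pos⟩).num :=
    fun i => I.num_eq i ⟨0, I.m_pos⟩
  have h1 : ∀ i : Fin I.n, I.den i 0 = (I.u i ⟨0, I.m_pos⟩).den :=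
    fun i => I.den_eq i ⟨0, I.m_pos⟩
  have : I.kind g = 0 ↔ I.distinguishers g = 0 := by
    unfold kind
    split_ifs <;> simp_all
  rw [this, distinguishers, Finset.sum_eq_zero_iff]
  constructor
  · intro h i
    have := h i (Finset.mem_range.2 i.2)
    rw [num_eq, den_eq, h0, h1] at this
    simp only [ite_eq_left_iff, one_ne_zero, imp_false, not_not] at this
    exact NNRat.ext_num_den this.1 this.2
  · intro h i hi
    have := h ⟨i, Finset.mem_range.1 hi⟩
    have e0 := h0 ⟨i, Finset.mem_range.1 hi⟩
    have e1 := h1 ⟨i, Finset.mem_range.1 hi⟩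
    have e2 := I.num_eq ⟨i, Finset.mem_range.1 hi⟩ g
    have e3 := I.den_eq ⟨i, Finset.mem_range.1 hi⟩ g
    dsimp only at e0 e1 e2 e3
    simp [e0, e1, e2, e3, this]

theorem kind_le_one (g : ℕ) : I.kind g ≤ 1 := by
  unfold kind
  split_ifs <;> simp

variable {I} in
-- The computed types may differ from the given partition, as goods of both groups can be valued
-- alike. But a good of kind 1 cannot share a group with good 0, so all of them lie in the one other
-- group.
theorem TwoTypes.eq_of_kind_eq (hI : I.TwoTypes) {g g' : Fin I.m} (h : I.kind g = I.kind g')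
    (i : Fin I.n) : I.u i g = I.u i g' := by
  by_cases h0 : I.kind g = 0
  · rw [(I.kind_eq_zero_iff g).1 h0, (I.kind_eq_zero_iff g').1 (h ▸ h0)]
  · obtain ⟨G, -, hG, hu⟩ := hI
    have hmem : ∀ g, ∃ r, g ∈ G r := fun g => by
      have : g ∈ G 0 ∪ G 1 := hG ▸ Set.mem_univ g
      exact this.elim (fun h => ⟨0, h⟩) fun h => ⟨1, h⟩
    obtain ⟨r, hr⟩ := hmem ⟨0, I.m_pos⟩
    obtain ⟨a, ha⟩ := hmem g
    obtain ⟨b, hb⟩ := hmem g'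
    have har : a ≠ r := by
      rintro rfl
      exact h0 ((I.kind_eq_zero_iff g).2 fun i => hu i a _ ha _ hr)
    have hbr : b ≠ r := by
      rintro rfl
      exact h0 (h ▸ (I.kind_eq_zero_iff g').2 fun i => hu i b _ hb _ hr)
    obtain rfl : a = b := by omega
    exact hu i a _ ha _ hb

theorem kindCount_succ (r k : ℕ) :
    I.kindCount r (k + 1) = I.kindCount r k + if I.kind k = r then 1 else 0 :=
  Finset.sum_range_succ _ _

theorem kindCount_mono (r : ℕ) : Monotone (I.kindCount r) :=
  monotone_nat_of_le_succ fun k => by rw [kindCount_succ]; omega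

theorem exists_of_lt_kindCount {r k b : ℕ} (h : k < I.kindCount r b) :
    ∃ a < b, I.kind a = r ∧ I.kindCount r a = k := by
  induction b with
  | zero => simp [kindCount] at h
  | succ b ih =>
    by_cases hb : k < I.kindCount r b
    · obtain ⟨a, ha, h'⟩ := ih hb
      exact ⟨a, by omega, h'⟩
    · rw [kindCount_succ] at h
      split_ifs at h with hr
      · exact ⟨b, by omega, hr, by omega⟩
      · omega

/-- If `a` is the wanted good, the first `g + 1` goods contain at most `k` of type `r` exactly when
`g < a`; counting these `g` gives `a`. -/
theorem nthGood_spec {r k : ℕ} (h : k < I.kindCount r I.m) :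
    I.nthGood r k < I.m ∧ I.kind (I.nthGood r k) = r ∧ I.kindCount r (I.nthGood r k) = k := by
  obtain ⟨a, ha, hr, hk⟩ := I.exists_of_lt_kindCount h
  suffices I.nthGood r k = a by rw [this]; exact ⟨ha, hr, hk⟩
  have hiff : ∀ g, I.kindCount r (g + 1) ≤ k ↔ g < a := fun g => by
    constructor
    · intro hg
      by_contra hga
      have := I.kindCount_mono r (show a + 1 ≤ g + 1 by omega)
      rw [kindCount_succ, if_pos hr] at this
      omega
    · intro hg
      exact hk ▸ I.kindCount_mono r hg
  simp only [nthGood, hiff]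
  rw [Finset.sum_boole, Nat.cast_id, show (Finset.range I.m).filter (· < a) = Finset.range a by
    ext g; simp; omega, Finset.card_range]

theorem kindCount_add (k : ℕ) : I.kindCount 0 k + I.kindCount 1 k = k := by
  induction k with
  | zero => simp [kindCount]
  | succ k ih =>
    rw [kindCount_succ, kindCount_succ]
    have := I.kind_le_one k
    split_ifs <;> omega

/-- Without goods of type 1, `nthGood 1 0` is `m`, and the reduction modulo `m` falls back to good
0. So `otherGood` always has a genuine, positive denominator. -/
theorem otherGood_lt : I.otherGood < I.m := Nat.mod_lt _ I.m_pos

theorem kind_otherGood (g : Fin I.m) (h : I.kind g = 1) : I.kind I.otherGood = 1 := by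
  have : 0 < I.kindCount 1 I.m :=
    lt_of_lt_of_le (by rw [kindCount_succ, if_pos h]; omega) (I.kindCount_mono 1 g.2)
  obtain ⟨h1, h2, -⟩ := I.nthGood_spec this
  rwa [otherGood, Nat.mod_eq_of_lt h1]

theorem card_filter_kind (M : I.Matching) (r : ℕ) :
    (Finset.univ.filter fun i => I.kind (M i) = r).card ≤ I.kindCount r I.m := by
  rw [kindCount, Finset.sum_boole, Nat.cast_id]
  refine Finset.card_le_card_of_injOn (fun i => (M i : ℕ)) (fun i hi => ?_)
    fun i _ j _ h => M.injective (Fin.ext h)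
  simpa using hi

/-- By injectivity, no type serves more agents than it has goods, and the two groups of agents add
up to `n`. -/
theorem sum_kind (M : I.Matching) :
    I.minOnes ≤ ∑ i, I.kind (M i) ∧ ∑ i, I.kind (M i) ≤ I.maxOnes := by
  have h0 := I.card_filter_kind M 0
  have h1 := I.card_filter_kind M 1
  have hs : ∑ i, I.kind (M i) = (Finset.univ.filter fun i => I.kind (M i) = 1).card := by
    rw [Finset.card_filter]
    refine Finset.sum_congr rfl fun i _ => ?_
    have := I.kind_le_one (M i)
    split_ifs <;> omega
  have hn : (Finset.univ.filter fun i => I.kind (M i) = 0).card +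
      (Finset.univ.filter fun i => I.kind (M i) = 1).card = I.n := by
    rw [Finset.card_filter, Finset.card_filter, ← Finset.sum_add_distrib,
      Finset.sum_congr rfl (g := fun _ => 1) fun i _ => ?_]
    · simp
    · have := I.kind_le_one (M i)
      split_ifs <;> omega
  rw [hs, minOnes, maxOnes]
  omega

/-! ### Scaled values -/

theorem den_pos (i : Fin I.n) (g : Fin I.m) : 0 < I.den i g := by
  rw [den_eq]
  exact NNRat.den_pos _

theorem scale_pos : 0 < I.scale :=
  Finset.prod_pos fun i hi => Nat.mul_pos
    (I.den_pos ⟨i, Finset.mem_range.1 hi⟩ ⟨0, I.m_pos⟩)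
    (I.den_pos ⟨i, Finset.mem_range.1 hi⟩ ⟨_, I.otherGood_lt⟩)

theorem scaled_eq (i : Fin I.n) (g : Fin I.m) (h : I.den i g ∣ I.scale) :
    ((I.num i g * (I.scale / I.den i g) : ℕ) : ℚ≥0) = I.scale * I.u i g := by
  have h0 : ((I.den i g : ℕ) : ℚ≥0) ≠ 0 := by exact_mod_cast (I.den_pos i g).ne'
  have hu : I.u i g = (I.num i g : ℚ≥0) / I.den i g := by
    rw [num_eq, den_eq, NNRat.num_div_den]
  rw [hu, Nat.cast_mul, Nat.cast_div h h0]
  ring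

theorem scale_mul (hI : I.TwoTypes) (i : Fin I.n) (g : Fin I.m) :
    I.scale * I.u i g = if I.kind g = 0 then (I.valZero i : ℚ≥0) else I.valOne i := by
  have hd : I.den i 0 * I.den i I.otherGood ∣ I.scale :=
    Finset.dvd_prod_of_mem (fun i => I.den i 0 * I.den i I.otherGood) (Finset.mem_range.2 i.2)
  split_ifs with h
  · rw [(I.kind_eq_zero_iff g).1 h, valZero]
    exact (I.scaled_eq i ⟨0, I.m_pos⟩ ((dvd_mul_right _ _).trans hd)).symm
  · have h1 : I.kind g = 1 := by have := I.kind_le_one g; omega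
    rw [hI.eq_of_kind_eq (g' := ⟨_, I.otherGood_lt⟩) (h1.trans (I.kind_otherGood g h1).symm),
      valOne]
    exact (I.scaled_eq i ⟨_, I.otherGood_lt⟩ ((dvd_mul_left _ _).trans hd)).symm

/-- The scaled value of agent `i` in a sequence in which it gets `x` goods of type `1`. -/
def reach (i x : ℕ) : ℕ := I.valZero i * (I.T - x) + I.valOne i * x

/-- The number of goods of type `1` that agent `i` gets in the sequence `l`. -/
def ones (l : List I.Matching) (i : Fin I.n) : ℕ := (l.map fun M => I.kind (M i)).sum

theorem ones_le (l : List I.Matching) (i : Fin I.n) : I.ones l i ≤ l.length := by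
  unfold ones
  induction l with
  | nil => simp
  | cons M l ih => have := I.kind_le_one (M i); simp; omega

theorem scale_mul_sum (hI : I.TwoTypes) (l : List I.Matching) (i : Fin I.n) :
    I.scale * (l.map fun M => I.u i (M i)).sum =
      ((I.valZero i * (l.length - I.ones l i) + I.valOne i * I.ones l i : ℕ) : ℚ≥0) := by
  induction l with
  | nil => simp [ones]
  | cons M l ih =>
    have h := I.ones_le l i
    have h' : I.ones (M :: l) i = I.kind (M i) + I.ones l i := by simp [ones]
    rw [List.map_cons, List.sum_cons, mul_add, ih, I.scale_mul hI, h', List.length_cons]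
    have := I.kind_le_one (M i)
    split_ifs with h0
    · rw [h0, zero_add, ← Nat.cast_add, Nat.sub_add_comm h]
      congr 1
      ring
    · rw [show I.kind (M i) = 1 by omega, add_comm 1, Nat.add_sub_add_right, ← Nat.cast_add]
      congr 1
      ring

theorem scale_mul_value (hI : I.TwoTypes) {S : List I.Matching} (hS : I.T ≤ S.length)
    (i : Fin I.n) : I.scale * I.value S I.T i = (I.reach i (I.ones (S.take I.T) i) : ℕ) := by
  rw [value, I.scale_mul_sum hI, reach, List.length_take, min_eq_left hS]

theorem sum_ones (l : List I.Matching) :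
    l.length * I.minOnes ≤ ∑ i, I.ones l i ∧ ∑ i, I.ones l i ≤ l.length * I.maxOnes := by
  induction l with
  | nil => simp [ones]
  | cons M l ih =>
    have h : ∑ i, I.ones (M :: l) i = ∑ i, I.kind (M i) + ∑ i, I.ones l i := by
      rw [← Finset.sum_add_distrib]
      simp [ones]
    have := I.sum_kind M
    rw [h, List.length_cons, add_mul, add_mul]
    omega

/-! ### Feasible targets -/

theorem reach_le (i x : ℕ) (hx : x ≤ I.T) :
    I.reach i x ≤ max (I.valZero i) (I.valOne i) * I.T := by
  calc I.reach i x ≤ max (I.valZero i) (I.valOne i) * (I.T - x) +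
        max (I.valZero i) (I.valOne i) * x := by
        unfold reach
        gcongr
        · exact le_max_left _ _
        · exact le_max_right _ _
    _ = _ := by rw [← mul_add, Nat.sub_add_cancel hx]

/-- The value is affine in `x`, so the condition is a bound from one side, rounded up in `lower` and
down in `upper`. The hypothesis `hv` makes the truncated subtraction in `upper` exact, and settles
the case of equal values, where `x` has no influence. -/
theorem le_reach_iff (v i x : ℕ) (hv : v ≤ max (I.valZero i) (I.valOne i) * I.T) (hx : x ≤ I.T) :
    v ≤ I.reach i x ↔ I.lower v i ≤ x ∧ x ≤ I.upper v i := by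
  unfold reach lower upper
  set a := I.valZero i
  set b := I.valOne i
  obtain ⟨y, hy⟩ := Nat.exists_eq_add_of_le hx
  rw [hy] at hv ⊢
  rw [Nat.add_sub_cancel_left]
  rcases lt_trichotomy a b with h | h | h
  · obtain ⟨d, hd⟩ := Nat.exists_eq_add_of_le h.le
    rw [if_pos h, if_neg (by omega), hd, Nat.add_sub_cancel_left,
      Nat.div_le_iff_le_mul_add_pred (by omega), add_mul, mul_add]
    omega
  · rw [if_neg (by omega), if_neg (by omega), ← h]
    rw [← h, max_self] at hv
    rw [← mul_add, add_comm y]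
    simp [hv]
  · obtain ⟨d, hd⟩ := Nat.exists_eq_add_of_le h.le
    rw [max_eq_left h.le] at hv
    rw [if_neg (by omega), if_pos h, hd, Nat.add_sub_cancel_left, le_min_iff,
      Nat.le_div_iff_mul_le (by omega), mul_comm x d]
    rw [hd] at hv
    have : (b + d) * (x + y) = (b + d) * y + b * x + d * x := by ring
    omega

theorem exists_reach_eq (i : ℕ) :
    ∃ x ≤ I.T, I.reach i x = max (I.valZero i) (I.valOne i) * I.T := by
  rcases le_total (I.valZero i) (I.valOne i) with h | h
  · exact ⟨I.T, le_rfl, by simp [reach, h]⟩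
  · exact ⟨0, Nat.zero_le _, by simp [reach, h]⟩

theorem lower_le_upper {v i : ℕ} (hv : v ≤ max (I.valZero i) (I.valOne i) * I.T) :
    I.lower v i ≤ I.upper v i := by
  obtain ⟨x, hx, h⟩ := I.exists_reach_eq i
  have := (I.le_reach_iff v i x hv hx).1 (h ▸ hv)
  omega

theorem upper_le (v i : ℕ) : I.upper v i ≤ I.T := by
  unfold upper
  split_ifs <;> simp

theorem hopeless_eq_zero_iff (v : ℕ) :
    I.hopeless v = 0 ↔ ∀ i < I.n, v ≤ max (I.valZero i) (I.valOne i) * I.T := by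
  simp [hopeless, Finset.sum_eq_zero_iff]

theorem minOnes_le_maxOnes : I.minOnes ≤ I.maxOnes := by
  have := I.kindCount_add I.m
  have := I.n_le_m
  unfold minOnes maxOnes
  omega

/-- `x` distributes the goods of type `1` such that the target `v` is reached. -/
structure Reaches (v : ℕ) (x : ℕ → ℕ) : Prop where
  le : ∀ i < I.n, x i ≤ I.T
  reach : ∀ i < I.n, v ≤ I.reach i (x i)
  minOnes : I.T * I.minOnes ≤ ∑ i ∈ Finset.range I.n, x i
  maxOnes : ∑ i ∈ Finset.range I.n, x i ≤ I.T * I.maxOnes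

variable {I}

theorem Reaches.feasible {v : ℕ} {x : ℕ → ℕ} (h : I.Reaches v x) : I.Feasible v := by
  have hv : ∀ i < I.n, v ≤ max (I.valZero i) (I.valOne i) * I.T :=
    fun i hi => (h.reach i hi).trans (I.reach_le i _ (h.le i hi))
  have hx : ∀ i < I.n, I.lower v i ≤ x i ∧ x i ≤ I.upper v i :=
    fun i hi => (I.le_reach_iff v i _ (hv i hi) (h.le i hi)).1 (h.reach i hi)
  exact ⟨(I.hopeless_eq_zero_iff v).2 hv,
    (Finset.sum_le_sum fun i hi => (hx i (Finset.mem_range.1 hi)).1).trans h.maxOnes,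
    h.minOnes.trans (Finset.sum_le_sum fun i hi => (hx i (Finset.mem_range.1 hi)).2)⟩

theorem lowers_succ (v i : ℕ) : I.lowers v (i + 1) = I.lowers v i + I.lower v i :=
  Finset.sum_range_succ _ _

theorem uppers_succ (v i : ℕ) : I.uppers v (i + 1) = I.uppers v i + I.upper v i :=
  Finset.sum_range_succ _ _

theorem cutFor_zero (v : ℕ) : I.cutFor v 0 = 0 := by simp [cutFor, lowers, uppers]

/-- Every agent gets its lower bound, and the deficit towards `T * minOnes` is filled greedily from
the first agent on. A minimum of two sequences, one growing by `lower` and one by `upper`, grows by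
an amount in between. -/
theorem Feasible.cutFor_succ {v i : ℕ} (hv : I.Feasible v) (hi : i < I.n) :
    I.cutFor v i + I.lower v i ≤ I.cutFor v (i + 1) ∧
      I.cutFor v (i + 1) ≤ I.cutFor v i + I.upper v i := by
  have := I.lower_le_upper ((I.hopeless_eq_zero_iff _).1 hv.1 i hi)
  unfold cutFor
  rw [lowers_succ, uppers_succ]
  omega

theorem Feasible.cutFor_le_succ {v i : ℕ} (hv : I.Feasible v) (hi : i < I.n) :
    I.cutFor v i ≤ I.cutFor v (i + 1) :=
  le_self_add.trans (hv.cutFor_succ hi).1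

theorem Feasible.cutFor_succ_le {v i : ℕ} (hv : I.Feasible v) (hi : i < I.n) :
    I.cutFor v (i + 1) ≤ I.cutFor v i + I.T :=
  (hv.cutFor_succ hi).2.trans (Nat.add_le_add_left (I.upper_le v i) _)

theorem Feasible.cutFor_n {v : ℕ} (hv : I.Feasible v) :
    I.T * I.minOnes ≤ I.cutFor v I.n ∧ I.cutFor v I.n ≤ I.T * I.maxOnes := by
  obtain ⟨-, h1, h2⟩ := hv
  have := Nat.mul_le_mul_left I.T I.minOnes_le_maxOnes
  unfold cutFor
  omega

theorem Feasible.reaches {v : ℕ} (hv : I.Feasible v) :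
    I.Reaches v fun i => I.cutFor v (i + 1) - I.cutFor v i := by
  have hx : ∀ i < I.n, I.cutFor v (i + 1) - I.cutFor v i ≤ I.T := fun i hi => by
    have := hv.cutFor_succ_le hi
    omega
  have hs : ∀ k ≤ I.n, ∑ i ∈ Finset.range k, (I.cutFor v (i + 1) - I.cutFor v i) =
      I.cutFor v k := by
    intro k hk
    induction k with
    | zero => simp [cutFor_zero]
    | succ k ih =>
      have := hv.cutFor_le_succ (i := k) (by omega)
      rw [Finset.sum_range_succ, ih (by omega)]
      omega
  refine ⟨hx, fun i hi => ?_, ?_, ?_⟩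
  · have := hv.cutFor_succ hi
    exact (I.le_reach_iff _ _ _ ((I.hopeless_eq_zero_iff _).1 hv.1 i hi) (hx i hi)).2
      (by omega)
  · rw [hs _ le_rfl]; exact hv.cutFor_n.1
  · rw [hs _ le_rfl]; exact hv.cutFor_n.2

/-- A distribution that reaches `v` also reaches `w`; this is what makes bisection legitimate. -/
theorem Feasible.anti {v w : ℕ} (hv : I.Feasible v) (h : w ≤ v) : I.Feasible w :=
  have hx := hv.reaches
  Reaches.feasible ⟨hx.le, fun i hi => h.trans (hx.reach i hi), hx.minOnes, hx.maxOnes⟩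

variable (I)

theorem feasible_zero : I.Feasible 0 := by
  -- Witness for target 0: the first `minOnes` agents get type 1 in all rounds.
  have hs : ∑ i ∈ Finset.range I.n, (if i < I.minOnes then I.T else 0) = I.T * I.minOnes := by
    have : I.minOnes ≤ I.n := Nat.sub_le _ _
    rw [← Finset.sum_filter, show (Finset.range I.n).filter (· < I.minOnes) =
      Finset.range I.minOnes by ext; simp; omega]
    simp [mul_comm]
  exact Reaches.feasible (x := fun i => if i < I.minOnes then I.T else 0)
    ⟨fun i _ => by split_ifs <;> simp, fun i _ => Nat.zero_le _, hs.ge,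
      hs.trans_le (Nat.mul_le_mul_left _ I.minOnes_le_maxOnes)⟩

theorem feasible_search (j : ℕ) : I.Feasible (I.search j) := by
  induction j with
  | zero => exact I.feasible_zero
  | succ j ih =>
    simp only [search]
    split_ifs with h
    · exact h
    · exact ih

theorem feasible_target : I.Feasible I.target := I.feasible_search _

/-- The upper half of the bisection invariant. It starts at `2 ^ bits`, which exceeds all that agent
0 can ever receive. -/
theorem not_feasible_search {j : ℕ} (hj : j ≤ I.bits) :
    ¬ I.Feasible (I.search j + 2 ^ (I.bits - j)) := by
  induction j with
  | zero =>
    intro h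
    have h1 := (I.hopeless_eq_zero_iff _).1 h.1 0 I.n_pos
    have h2 := Nat.lt_size_self (max (I.valZero 0) (I.valOne 0) * I.T)
    simp only [search, Nat.sub_zero, zero_add, bits] at h1
    omega
  | succ j ih =>
    simp only [search]
    split_ifs with h
    · rw [add_assoc, ← two_mul, ← pow_succ', show I.bits - (j + 1) + 1 = I.bits - j by omega]
      exact ih (by omega)
    · exact h

variable {I} in
theorem Feasible.le_target {v : ℕ} (hv : I.Feasible v) : v ≤ I.target := by
  by_contra h
  refine I.not_feasible_search le_rfl (hv.anti ?_)
  simp only [target] at h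
  simp
  omega

/-! ### The matchings of the single rounds -/

theorem cut_zero : I.cut 0 = 0 := cutFor_zero _

theorem onesBefore_zero {t : ℕ} (ht : t < I.T) : I.onesBefore t 0 = 0 := by
  rw [onesBefore, cut_zero, zero_add, Nat.div_eq_of_lt ht]

theorem onesBefore_le_succ (t : ℕ) {i : ℕ} (hi : i < I.n) :
    I.onesBefore t i ≤ I.onesBefore t (i + 1) :=
  Nat.div_le_div_right (Nat.add_le_add_right (I.feasible_target.cutFor_le_succ hi) _)

theorem onesBefore_succ_le (t : ℕ) {i : ℕ} (hi : i < I.n) :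
    I.onesBefore t (i + 1) ≤ I.onesBefore t i + 1 := by
  have h : I.cut (i + 1) ≤ I.cut i + I.T := I.feasible_target.cutFor_succ_le hi
  rw [onesBefore, onesBefore, ← Nat.add_div_right _ I.T_pos]
  exact Nat.div_le_div_right (by omega)

/-- The second inequality says that the number of earlier agents with a good of type 0 is monotone
too. -/
theorem onesBefore_mono (t : ℕ) {i j : ℕ} (hij : i ≤ j) (hj : j ≤ I.n) :
    I.onesBefore t i ≤ I.onesBefore t j ∧ I.onesBefore t j + i ≤ I.onesBefore t i + j := by
  induction j, hij using Nat.le_induction with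
  | base => simp
  | succ j hij ih =>
    have := ih (by omega)
    have := I.onesBefore_le_succ t (i := j) (by omega)
    have := I.onesBefore_succ_le t (i := j) (by omega)
    omega

theorem onesBefore_n {t : ℕ} (ht : t < I.T) :
    I.minOnes ≤ I.onesBefore t I.n ∧ I.onesBefore t I.n ≤ I.maxOnes := by
  obtain ⟨h1, h2⟩ : I.T * I.minOnes ≤ I.cut I.n ∧ I.cut I.n ≤ I.T * I.maxOnes :=
    I.feasible_target.cutFor_n
  constructor
  · rw [onesBefore, Nat.le_div_iff_mul_le I.T_pos, mul_comm]
    omega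
  · rw [onesBefore, ← Nat.lt_succ_iff, Nat.div_lt_iff_lt_mul I.T_pos, Nat.succ_mul, mul_comm]
    omega

theorem goodAt_spec {t i : ℕ} (ht : t < I.T) (hi : i < I.n) :
    I.goodAt t i < I.m ∧
      (I.kind (I.goodAt t i) = 0 ∧ I.onesBefore t (i + 1) = I.onesBefore t i ∧
          I.kindCount 0 (I.goodAt t i) = i - I.onesBefore t i ∨
        I.kind (I.goodAt t i) = 1 ∧ I.onesBefore t (i + 1) = I.onesBefore t i + 1 ∧
          I.kindCount 1 (I.goodAt t i) = I.onesBefore t i) := by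
  have hadd := I.kindCount_add I.m
  obtain ⟨hn, hn'⟩ := I.onesBefore_n ht
  have h0 := I.onesBefore_zero ht
  have hm := I.onesBefore_mono t (Nat.zero_le i) hi.le
  have hm' := I.onesBefore_mono t (show i + 1 ≤ I.n from hi) le_rfl
  have hs := I.onesBefore_le_succ t hi
  have hs' := I.onesBefore_succ_le t hi
  unfold minOnes at hn
  unfold maxOnes at hn'
  unfold goodAt
  split_ifs with h
  · obtain ⟨h1, h2, h3⟩ := I.nthGood_spec (r := 0) (k := i - I.onesBefore t i) (by omega)
    exact ⟨h1, .inl ⟨h2, h.symm, h3⟩⟩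
  · obtain ⟨h1, h2, h3⟩ := I.nthGood_spec (r := 1) (k := I.onesBefore t i) (by omega)
    exact ⟨h1, .inr ⟨h2, by omega, h3⟩⟩

/-- A good determines its type and its rank within the type, and the rank strictly increases along
the agents served with one type. -/
theorem goodAt_ne {t i j : ℕ} (ht : t < I.T) (hij : i < j) (hj : j < I.n) :
    I.goodAt t i ≠ I.goodAt t j := by
  intro h
  have h1 := (I.goodAt_spec ht (hij.trans hj)).2
  have h2 := (I.goodAt_spec ht hj).2
  have h3 := I.onesBefore_mono t (show i + 1 ≤ j from hij) hj.le
  have h4 := I.onesBefore_mono t (Nat.zero_le i) (hij.trans hj).le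
  have h5 := I.onesBefore_zero ht
  rw [h] at h1
  omega

/-- The matching of round `t`. -/
def matchingAt (t : ℕ) : I.Matching where
  -- Empty blocks can start at `t = T` and still need a matching; the reduction modulo `T` supplies
  -- one.
  toFun i := ⟨I.goodAt (t % I.T) i, (I.goodAt_spec (Nat.mod_lt _ I.T_pos) i.2).1⟩
  inj' i j h := by
    have ht := Nat.mod_lt t I.T_pos
    have h' : I.goodAt (t % I.T) i = I.goodAt (t % I.T) j := Fin.mk.inj_iff.1 h
    rcases lt_trichotomy i j with hij | hij | hij
    · exact absurd h' (I.goodAt_ne ht hij j.2)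
    · exact hij
    · exact absurd h'.symm (I.goodAt_ne ht hij i.2)

/-- Hermite's identity: passing from `c` to `c + 1` shifts the window, dropping `c / T` and gaining
`(c + T) / T`, which is one more. -/
theorem sum_add_div (c T : ℕ) (hT : 0 < T) : ∑ t ∈ Finset.range T, (c + t) / T = c := by
  induction c with
  | zero =>
    exact Finset.sum_eq_zero fun t ht => by
      rw [zero_add, Nat.div_eq_of_lt (Finset.mem_range.1 ht)]
  | succ c ih =>
    have h1 := Finset.sum_range_succ (fun t => (c + t) / T) T
    have h2 := Finset.sum_range_succ' (fun t => (c + t) / T) T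
    have h3 : (c + T) / T = c / T + 1 := Nat.add_div_right _ hT
    have h4 : ∑ t ∈ Finset.range T, (c + 1 + t) / T = ∑ t ∈ Finset.range T, (c + (t + 1)) / T :=
      Finset.sum_congr rfl fun t _ => by rw [add_assoc, add_comm 1]
    simp only [add_zero] at h2
    omega

/-- The sequence that consists of the matchings of rounds `0`, …, `T - 1`. -/
def schedule : List I.Matching := (List.range I.T).map I.matchingAt

theorem ones_schedule (i : Fin I.n) : I.ones I.schedule i = I.cut (i + 1) - I.cut i := by
  have h : I.ones I.schedule i + ∑ t ∈ Finset.range I.T, I.onesBefore t i =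
      ∑ t ∈ Finset.range I.T, I.onesBefore t (i + 1) := by
    rw [ones, schedule, List.map_map]
    change ∑ t ∈ Finset.range I.T, _ + _ = _
    rw [← Finset.sum_add_distrib]
    refine Finset.sum_congr rfl fun t ht => ?_
    have ht := Finset.mem_range.1 ht
    have := (I.goodAt_spec ht i.2).2
    simp only [Function.comp, matchingAt, Function.Embedding.coeFn_mk, Nat.mod_eq_of_lt ht]
    omega
  simp only [onesBefore, sum_add_div _ _ I.T_pos] at h
  omega

/-! ### The blocks -/

theorem breakpoint_spec (t i : ℕ) (ht : t < I.T) :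
    I.onesBefore t i = I.cut i / I.T + if I.breakpoint i ≤ t then 1 else 0 := by
  have hm := Nat.mod_lt (I.cut i) I.T_pos
  have h := Nat.div_add_mod (I.cut i) I.T
  rw [onesBefore, breakpoint, ← h, add_assoc, Nat.mul_add_div I.T_pos, h]
  congr 1
  split_ifs with hb
  · rw [Nat.div_eq_iff I.T_pos]
    omega
  · exact Nat.div_eq_of_lt (by omega)

theorem breakpoint_zero : I.breakpoint 0 = I.T := by simp [breakpoint, cut_zero]

theorem lt_nextBreak {t : ℕ} (ht : t < I.T) (k : ℕ) : t < I.nextBreak t k := by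
  induction k with
  | zero => exact ht
  | succ k ih =>
    simp only [nextBreak]
    split_ifs <;> omega

theorem nextBreak_le_breakpoint {t i k : ℕ} (hi : i < k) (ht : t < I.breakpoint i) :
    I.nextBreak t k ≤ I.breakpoint i := by
  induction k with
  | zero => omega
  | succ k ih =>
    rcases Nat.lt_succ_iff_lt_or_eq.1 hi with h | rfl
    · have := ih h
      simp only [nextBreak]
      split_ifs <;> omega
    · simp only [nextBreak]
      split_ifs <;> omega

theorem exists_nextBreak_eq (t k : ℕ) :
    ∃ i < k + 1, I.nextBreak t (k + 1) = I.breakpoint i := by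
  suffices ∀ k, I.nextBreak t k = I.T ∨ ∃ i < k, I.nextBreak t k = I.breakpoint i by
    rcases this (k + 1) with h | h
    · exact ⟨0, by omega, by rw [h, breakpoint_zero]⟩
    · exact h
  intro k
  induction k with
  | zero => exact .inl rfl
  | succ k ih =>
    simp only [nextBreak]
    split_ifs
    · exact .inr ⟨k, by omega, rfl⟩
    · exact ih.imp_right fun ⟨i, hi, h⟩ => ⟨i, by omega, h⟩

theorem nextBreak_self (k : ℕ) : I.nextBreak I.T k = I.T := by
  induction k with
  | zero => rfl
  | succ k ih =>
    have : I.breakpoint k ≤ I.T := Nat.sub_le _ _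
    rw [nextBreak, if_neg (by omega), ih]

/-- Before `T` is reached, each new block passes at least one more breakpoint. -/
theorem start_T_or (j : ℕ) : I.start j = I.T ∨
    j ≤ ((Finset.range (I.n + 1)).filter fun i => I.breakpoint i ≤ I.start j).card := by
  induction j with
  | zero => exact .inr (Nat.zero_le _)
  | succ j ih =>
    by_cases hT : I.start j = I.T
    · exact .inl (by rw [start, hT, nextBreak_self])
    · right
      have hlt := lt_of_le_of_ne (I.start_le j) hT
      refine (Nat.succ_le_succ (ih.resolve_left hT)).trans (Finset.card_lt_card ?_)
      obtain ⟨i, hi, h⟩ := I.exists_nextBreak_eq (I.start j) I.n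
      have hb : I.start j < I.start (j + 1) := I.lt_nextBreak hlt _
      have h : I.start (j + 1) = I.breakpoint i := h
      rw [Finset.ssubset_iff_of_subset]
      · exact ⟨i, by simp [h]; omega, by simp; omega⟩
      · exact Finset.monotone_filter_right _ fun k _ hk => hk.trans hb.le

/-- There are only `n + 1` breakpoints; once all are passed, so is `breakpoint 0`, which equals `T`.
-/
theorem start_last : I.start (I.n + 1) = I.T := by
  rcases I.start_T_or (I.n + 1) with h | h
  · exact h
  · have := Finset.eq_of_subset_of_card_le (Finset.filter_subset _ _)
      (by rwa [Finset.card_range] : (Finset.range (I.n + 1)).card ≤ _)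
    have h0 : 0 ∈ Finset.range (I.n + 1) := by simp
    rw [← this, Finset.mem_filter, breakpoint_zero] at h0
    exact le_antisymm (I.start_le _) h0.2

/-- No breakpoint lies after `start j` and up to `t`, so none of the quotients that define the
matching changes. -/
theorem matchingAt_eq {j t : ℕ} (h : I.start j ≤ t) (h' : t < I.start (j + 1)) :
    I.matchingAt t = I.matchingAt (I.start j) := by
  have ht : t < I.T := h'.trans_le (I.start_le _)
  have key : ∀ i ≤ I.n, I.onesBefore t i = I.onesBefore (I.start j) i := fun i hi => by
    rw [breakpoint_spec _ _ _ ht, breakpoint_spec _ _ _ (h.trans_lt ht)]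
    congr 2
    refine propext ⟨fun hb => ?_, fun hb => hb.trans h⟩
    by_contra hb'
    exact absurd (h'.trans_le (I.nextBreak_le_breakpoint (Nat.lt_succ_of_le hi) (not_le.1 hb')))
      (not_lt.2 hb)
  ext i
  simp only [matchingAt, Function.Embedding.coeFn_mk, Nat.mod_eq_of_lt ht,
    Nat.mod_eq_of_lt (h.trans_lt ht), goodAt, key i i.2.le, key (i + 1) i.2]

theorem start_mono (j : ℕ) : I.start j ≤ I.start (j + 1) := by
  rcases (I.start_le j).lt_or_eq with h | h
  · exact (I.lt_nextBreak h _).le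
  · rw [start, h, nextBreak_self]

/-- The output, as a run-length description. -/
def runs : List (ℕ × I.Matching) :=
  (List.range (I.n + 1)).map fun j => (I.start (j + 1) - I.start j, I.matchingAt (I.start j))

theorem encodeRuns_runs : I.encodeRuns I.runs = I.output := by
  rw [encodeRuns, runs, output, List.flatMap_map]
  congr 1
  funext j
  rw [List.singleton_append]
  congr 1
  refine List.ext_getElem (by simp) fun i h h' => ?_
  simp only [List.getElem_ofFn, List.getElem_map, List.getElem_range]
  rfl

theorem expand_runs : I.expand I.runs = I.schedule := by
  suffices ∀ k, (List.range k).flatMap (fun j => List.replicate (I.start (j + 1) - I.start j)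
      (I.matchingAt (I.start j))) = (List.range (I.start k)).map I.matchingAt by
    rw [expand, runs, List.flatMap_map, this, start_last, schedule]
  intro k
  induction k with
  | zero => simp [start]
  | succ k ih =>
    obtain ⟨d, hd⟩ := Nat.exists_eq_add_of_le (I.start_mono k)
    rw [List.range_succ, List.flatMap_append, ih, List.flatMap_singleton, hd,
      Nat.add_sub_cancel_left, List.range_add, List.map_append, List.map_map]
    congr 1
    symm
    rw [List.eq_replicate_iff]
    refine ⟨by simp, fun M hM => ?_⟩
    obtain ⟨t, ht, rfl⟩ := List.mem_map.1 hM
    exact I.matchingAt_eq (Nat.le_add_right _ _) (by rw [hd]; simpa using ht)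

/-! ### Optimality -/

variable {I}

theorem TwoTypes.bottleneck_le (hI : I.TwoTypes) {S : List I.Matching} (hS : I.T ≤ S.length) :
    I.scale * I.bottleneck I.T S ≤ I.target := by
  have hlen : (S.take I.T).length = I.T := by rw [List.length_take, min_eq_left hS]
  obtain ⟨i₀, -, h₀⟩ := Finset.exists_mem_eq_inf' ⟨⟨0, I.n_pos⟩, Finset.mem_univ _⟩
    (I.value S I.T)
  have hb : I.bottleneck I.T S = I.value S I.T i₀ := h₀
  -- At a worst-off agent the scaled bottleneck is a natural number, hence a candidate target; the
  -- counts of `S` show that it is feasible.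
  rw [hb, I.scale_mul_value hI hS, Nat.cast_le]
  set x : ℕ → ℕ := fun i => if h : i < I.n then I.ones (S.take I.T) ⟨i, h⟩ else 0 with hx
  have hxi : ∀ i (h : i < I.n), x i = I.ones (S.take I.T) ⟨i, h⟩ := fun i h => dif_pos h
  have hsum : ∑ i ∈ Finset.range I.n, x i = ∑ i, I.ones (S.take I.T) i := by
    rw [Finset.sum_range]
    exact Finset.sum_congr rfl fun i _ => hxi i i.2
  have hs := I.sum_ones (S.take I.T)
  rw [hlen, ← hsum] at hs
  refine (Reaches.feasible (x := x) ⟨fun i hi => ?_, fun i hi => ?_, hs.1, hs.2⟩).le_target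
  · rw [hxi i hi]
    exact (I.ones_le _ _).trans_eq hlen
  · rw [hxi i hi, ← Nat.cast_le (α := ℚ≥0), ← I.scale_mul_value hI hS,
      ← hb]
    refine le_of_le_of_eq ?_ (I.scale_mul_value hI hS ⟨i, hi⟩)
    gcongr
    exact Finset.inf'_le _ (Finset.mem_univ _)

variable (I) in
theorem length_schedule : I.schedule.length = I.T := by simp [schedule]

theorem TwoTypes.le_bottleneck_schedule (hI : I.TwoTypes) :
    I.target ≤ I.scale * I.bottleneck I.T I.schedule := by
  obtain ⟨i₀, -, h₀⟩ := Finset.exists_mem_eq_inf' ⟨⟨0, I.n_pos⟩, Finset.mem_univ _⟩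
    (I.value I.schedule I.T)
  have hb : I.bottleneck I.T I.schedule = I.value I.schedule I.T i₀ := h₀
  rw [hb, I.scale_mul_value hI I.length_schedule.ge, Nat.cast_le,
    List.take_of_length_le I.length_schedule.le, ones_schedule]
  exact I.feasible_target.reaches.reach i₀ i₀.2

theorem TwoTypes.isOptimalOutput (hI : I.TwoTypes) : I.IsOptimalOutput I.output := by
  refine ⟨I.runs, I.encodeRuns_runs.symm, ?_⟩
  rw [expand_runs]
  have hmem : I.schedule ∈ I.sequences I.T := I.length_schedule.ge
  refine ⟨I.length_schedule, hmem, ⟨I.schedule, hmem, rfl⟩, ?_⟩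
  rintro _ ⟨S, hS, rfl⟩
  have h0 : (0 : ℚ≥0) < I.scale := by exact_mod_cast I.scale_pos
  exact le_of_mul_le_mul_left ((hI.bottleneck_le hS).trans hI.le_bottleneck_schedule) h0

end Correctness

end RepeatedMatching

theorem mainTheorem10 :
    RAM.SolvableInPolyTime RepeatedMatching.encode
      {I : RepeatedMatching | I.TwoTypes} RepeatedMatching.IsOptimalOutput :=
  RAM.solvableInPolyTime_of_emits RepeatedMatching.emits_output fun _ hI =>
    RepeatedMatching.TwoTypes.isOptimalOutput hI
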